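/- Let $k$ be a field, $S=k[x_1,\dots,x_n]$, let $\mathfrak a\subseteq\langle x_1,\dots,x_n\rangle$ be an ideal of $S$ and $A=S/\mathfrak a$, so that $k\cong A/\langle x_1,\dots,x_n\rangle$. Let $\prec$ be the degree-lexicographic order with $x_1\succ\dots\succ x_n$, let $\mathrm{in}(\mathfrak a)$ be the initial ideal, $\mathrm{MinGen}(\mathrm{in}(\mathfrak a))$ its minimal monomial generating set, and $\mathcal G$ the set of standard monomials (monomials not in $\mathrm{in}(\mathfrak a)$) of degree $\ge 1$. A monomial is called reducible if it lies in $\mathrm{in}(\mathfrak a)$. For a monomial $w\ne 1$ put $m(w)=\min\{i : x_i\mid w\}$. *Minimal fully attached tuples* are tuples of elements of $\mathcal G$ defined recursively. A pair $(w_1,w_2)$ is minimal fully attached if $w_1=x_{m(w_1w_2)}$ and $w_1w_2\in\mathrm{MinGen}(\mathrm{in}(\mathfrak a))$. For $l>2$, a tuple $(w_1,\dots,w_l)$ is minimal fully attached if $(w_1,\dots,w_{l-1})$ is, $m(w_1)<m(w_l)$, and $w=w_l$ satisfies one of the following two conditions while no proper divisor of $w_l$ satisfies either of them: 1. $w_{l-1}w$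 is reducible; 2. $w_{l-1}w=uv\in\mathcal G$ for monomials $u,v$ such that $u\succ w_{l-1}$ and $(w_1,\dots,w_{l-2},u)$ is minimal fully attached. Let $\mathcal L$ be the set of all finite words (including the empty one) whose letters are minimal fully attached tuples and in which a letter with first entry $x_i$ is never immediately followed by a letter with first entry $x_j\prec x_i$. For $w\in\mathcal L$ let $|w|$ be the total number of entries of all its letters, let $x^{w}$ be the product of all these entries, and put $$F(x,t)=\sum_{w\in\mathcal L}x^{w}\,t^{|w|}.$$ (a) If $\mathfrak a$ is homogeneous for the multigrading $\deg x_i=e_i\in\mathbb N^n$, then all $\operatorname{Tor}^A_i(k,k)_\alpha$ are finite-dimensional and the multigraded Poincaré–Betti series satisfies, coefficientwise, $$\sum_{i\ge 0,\ \alpha\in\mathbb N^n}\dim_k\operatorname{Tor}^A_i(k,k)_\alpha\,x^\alpha t^i\ \le\ \prod_{i=1}^n(1+x_it)\cdot F(x,t).$$ (b) More generally, write $\prod_{i=1}^n(1+x_it)\,F(x,t)=\sum_{i,\alpha} c_{i,\alpha}x^\alpha t^i$. For each $i$ only finitely many $c_{i,\alpha}$ are nonzero. If $\Gamma$ is a commutative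 (additive) monoid, $d_1,\dots,d_n\in\Gamma$, and $\mathfrak a$ is homogeneous for the $\Gamma$-grading $\deg x_j=d_j$, then for all $i\ge 0$ and $\gamma\in\Gamma$ $$\dim_k\operatorname{Tor}^A_i(k,k)_\gamma\ \le\ \sum_{\alpha\in\mathbb N^n:\ \alpha_1d_1+\dots+\alpha_nd_n=\gamma}c_{i,\alpha}.$$ In particular (trivial $\Gamma$), for every $\mathfrak a\subseteq\langle x_1,\dots,x_n\rangle$ the Betti numbers are bounded by $\dim_k\operatorname{Tor}^A_i(k,k)\le\sum_\alpha c_{i,\alpha}$. Here $\operatorname{Tor}^A_i(k,k)_\gamma$ is the degree-$\gamma$ part of $H_i(k\otimes_A F_\bullet)$ for any graded free resolution $F_\bullet$ of $k$ over $A$; the inequalities are asserted for every such resolution. -/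

import Mathlib

open MvPolynomial TensorProduct
open scoped MonomialOrder

universe u v w

namespace AnickCommutative

/-! ### Standard monomials and the initial ideal

Monomials of `S = k[x_0, …, x_{n-1}]` are identified with their exponent vectors
`Fin n →₀ ℕ`; thus `0` is the monomial `1`, `+` is multiplication, and `≤` is divisibility.
The monomial order is degree-lex with `x_0 ≻ x_1 ≻ ⋯ ≻ x_{n-1}`. -/

section Monomials

variable {k : Type u} [Field k] {n : ℕ}

/-- The monomials lying in the initial ideal of `a` with respect to degree-lex. Over a field
these are exactly the leading monomials of the nonzero elements of `a`. A monomial is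
reducible iff it lies in this set. -/
def initialMonomials (a : Ideal (MvPolynomial (Fin n) k)) : Set (Fin n →₀ ℕ) :=
  {w | ∃ f ∈ a, f ≠ 0 ∧ MonomialOrder.degLex.degree f = w}

/-- The minimal monomial generating system of the initial ideal of `a`. -/
def minGenInitial (a : Ideal (MvPolynomial (Fin n) k)) : Set (Fin n →₀ ℕ) :=
  {w | Minimal (fun v => v ∈ initialMonomials a) w}

/-- The standard monomials of degree at least `1`. -/
def standardMonomials (a : Ideal (MvPolynomial (Fin n) k)) : Set (Fin n →₀ ℕ) :=
  {w | w ≠ 0 ∧ w ∉ initialMonomials a}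

/-! ### Minimal fully attached tuples -/

/-- The two alternatives in the definition of a minimal fully attached tuple
`(pre, b, c)`: either `b * c` is reducible, or `b * c = u * v` is standard with `u ≻ b` and
`(pre, u)` satisfies `prev`, where `prev` stands for being minimal fully attached and one entry
shorter. -/
def AttachingCondition (a : Ideal (MvPolynomial (Fin n) k))
    (prev : List (Fin n →₀ ℕ) → Prop) (pre : List (Fin n →₀ ℕ)) (b c : Fin n →₀ ℕ) : Prop :=
  b + c ∈ initialMonomials a ∨
    (b + c ∈ standardMonomials a ∧
      ∃ u v : Fin n →₀ ℕ, b + c = u + v ∧ b ≺[MonomialOrder.degLex] u ∧ prev (pre ++ [u]))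

/-- `IsMinFullyAttachedOfLength a l t`: the list `t` is a minimal fully attached `l`-tuple of
standard monomials (there are none for `l ≤ 1`).

* A pair is minimal fully attached iff it is `(x_i, w₂)` with `x_i w₂` a minimal generator of the
  initial ideal and `i` the smallest index of a variable dividing `x_i w₂`.
* A tuple `(x_i, w₂, …, b, c)` with at least three entries is minimal fully attached iff
  `(x_i, w₂, …, b)` is, all variables dividing `c` have index larger than `i`, and `c` is minimal
  for divisibility among the monomials that satisfy the attaching condition. -/
def IsMinFullyAttachedOfLength (a : Ideal (MvPolynomial (Fin n) k)) :
    ℕ → List (Fin n →₀ ℕ) → Prop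
  | 0, _ => False
  | 1, _ => False
  | 2, t => ∃ (i : Fin n) (w₂ : Fin n →₀ ℕ), t = [Finsupp.single i 1, w₂] ∧
      Finsupp.single i 1 ∈ standardMonomials a ∧ w₂ ∈ standardMonomials a ∧
      Finsupp.single i 1 + w₂ ∈ minGenInitial a ∧ ∀ j ∈ w₂.support, i ≤ j
  | l + 3, t => ∃ (pre : List (Fin n →₀ ℕ)) (b c : Fin n →₀ ℕ), t = pre ++ [b, c] ∧
      IsMinFullyAttachedOfLength a (l + 2) (pre ++ [b]) ∧
      c ∈ standardMonomials a ∧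
      (∃ i : Fin n, pre.head? = some (Finsupp.single i 1) ∧ ∀ j ∈ c.support, i < j) ∧
      AttachingCondition a (IsMinFullyAttachedOfLength a (l + 2)) pre b c ∧
      ∀ c' : Fin n →₀ ℕ, c' ≤ c → c' ≠ c →
        ¬ AttachingCondition a (IsMinFullyAttachedOfLength a (l + 2)) pre b c'

/-- Minimal fully attached tuples, of any length. -/
def IsMinFullyAttached (a : Ideal (MvPolynomial (Fin n) k)) (t : List (Fin n →₀ ℕ)) : Prop :=
  IsMinFullyAttachedOfLength a t.length t

/-! ### The language and its counting series -/

/-- The forbidden two-letter words: `[x_i|…][x_j|…]` with `x_j ≺ x_i`. -/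
def Forbidden (p q : List (Fin n →₀ ℕ)) : Prop :=
  ∃ (x y : Fin n →₀ ℕ) (s t : List (Fin n →₀ ℕ)),
    p = x :: s ∧ q = y :: t ∧ y ≺[MonomialOrder.degLex] x

/-- The words over the alphabet of minimal fully attached tuples without forbidden
two-letter subword. A word is a list of letters, and a letter is a list of monomials. -/
def language (a : Ideal (MvPolynomial (Fin n) k)) : Set (List (List (Fin n →₀ ℕ))) :=
  {W | (∀ p ∈ W, IsMinFullyAttached a p) ∧ W.IsChain (fun p q => ¬ Forbidden p q)}

/-- A word read as a monomial: the product of all entries of all letters. -/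
noncomputable def wordMonomial (W : List (List (Fin n →₀ ℕ))) : Fin n →₀ ℕ :=
  (W.map List.sum).sum

/-- The length of a word: the total number of entries of its letters, which is the homological
degree of the corresponding element `[w₁|w₂|…]` of the bar resolution. -/
def wordLength (W : List (List (Fin n →₀ ℕ))) : ℕ :=
  (W.map List.length).sum

/-- `F(x,t) = ∑_W W t^{|W|}` over the words of the language, as a power series in `t` over the
power series in `x_0, …, x_{n-1}`. There are only finitely many words with a given monomial. -/
noncomputable def wordSeries (a : Ideal (MvPolynomial (Fin n) k)) :
    PowerSeries (MvPowerSeries (Fin n) ℕ) :=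
  PowerSeries.mk fun l => fun α =>
    Nat.card {W // W ∈ language a ∧ wordMonomial W = α ∧ wordLength W = l}

/-- `∏ (1 + x_i t) · F(x,t)`. -/
noncomputable def boundSeries (a : Ideal (MvPolynomial (Fin n) k)) :
    PowerSeries (MvPowerSeries (Fin n) ℕ) :=
  (∏ i : Fin n, (1 + PowerSeries.C (MvPowerSeries.X i) * PowerSeries.X)) * wordSeries a

end Monomials

/-! ### Graded `Tor`

`A` is a commutative `k`-algebra graded by the family `𝒜 : Γ → Submodule k A`, and `𝔪` is an ideal
of `A`. The quotient `A ⧸ 𝔪` is regarded as an `A`-module concentrated in degree `0`. -/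

section GradedTor

variable {k : Type u} [Field k] {A : Type u} [CommRing A] [Algebra k A]
  {Γ : Type w} [AddCommMonoid Γ]

/-- The degree-`γ` part of the free `A`-module with basis `(e_b)_b`, where `e_b` has degree
`deg b`: it is spanned by the `r e_b` with `r ∈ A_δ` and `δ + deg b = γ`. -/
noncomputable def freeComponent (𝒜 : Γ → Submodule k A) {ι : Type v} (deg : ι → Γ) (γ : Γ) :
    Submodule k (ι →₀ A) :=
  Submodule.span k {x | ∃ (b : ι) (δ : Γ) (r : A),
    r ∈ 𝒜 δ ∧ δ + deg b = γ ∧ x = Finsupp.single b r}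

/-- A `Γ`-graded free resolution `⋯ → F₂ → F₁ → F₀ → A ⧸ 𝔪 → 0` over `A`, with homogeneous bases
indexed by `basis i` and maps of degree `0`. -/
structure GradedFreeResolution (𝒜 : Γ → Submodule k A) (𝔪 : Ideal A) where
  /-- index set of the basis of `F_i` -/
  basis : ℕ → Type v
  /-- degrees of the basis elements -/
  deg : ∀ i, basis i → Γ
  /-- the differential `F_{i+1} → F_i` -/
  diff : ∀ i, (basis (i + 1) →₀ A) →ₗ[A] (basis i →₀ A)
  /-- the augmentation `F₀ → A ⧸ 𝔪` -/
  aug : (basis 0 →₀ A) →ₗ[A] A ⧸ 𝔪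
  diff_homogeneous : ∀ i γ, ∀ x ∈ freeComponent 𝒜 (deg (i + 1)) γ,
    diff i x ∈ freeComponent 𝒜 (deg i) γ
  aug_homogeneous : ∀ γ, γ ≠ 0 → ∀ x ∈ freeComponent 𝒜 (deg 0) γ, aug x = 0
  aug_surjective : Function.Surjective aug
  exact_zero : Function.Exact (diff 0) aug
  exact_succ : ∀ i, Function.Exact (diff (i + 1)) (diff i)

namespace GradedFreeResolution

variable {𝒜 : Γ → Submodule k A} {𝔪 : Ideal A}

/-- The module `(A ⧸ 𝔪) ⊗_A F_i`. -/
abbrev Tensored (R : GradedFreeResolution.{u, v, w} 𝒜 𝔪) (i : ℕ) : Type (max u v) :=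
  (A ⧸ 𝔪) ⊗[A] (R.basis i →₀ A)

/-- The degree-`γ` part of `(A ⧸ 𝔪) ⊗_A F_i`: the image of the degree-`γ` part of `F_i`. -/
noncomputable def tensorComponent (R : GradedFreeResolution.{u, v, w} 𝒜 𝔪) (i : ℕ) (γ : Γ) :
    Submodule k (R.Tensored i) :=
  (freeComponent 𝒜 (R.deg i) γ).map
    ((TensorProduct.mk A (A ⧸ 𝔪) (R.basis i →₀ A) 1).restrictScalars k)

/-- The differential `(A ⧸ 𝔪) ⊗_A F_{i+1} → (A ⧸ 𝔪) ⊗_A F_i`. -/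
noncomputable def tensorDiff (R : GradedFreeResolution.{u, v, w} 𝒜 𝔪) (i : ℕ) :
    R.Tensored (i + 1) →ₗ[k] R.Tensored i :=
  ((R.diff i).lTensor (A ⧸ 𝔪)).restrictScalars k

/-- The `i`-cycles of `(A ⧸ 𝔪) ⊗_A F` of degree `γ`. -/
noncomputable def cycles (R : GradedFreeResolution.{u, v, w} 𝒜 𝔪) :
    (i : ℕ) → (γ : Γ) → Submodule k (R.Tensored i)
  | 0, γ => R.tensorComponent 0 γ
  | i + 1, γ => R.tensorComponent (i + 1) γ ⊓ LinearMap.ker (R.tensorDiff i)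

/-- The `i`-boundaries of `(A ⧸ 𝔪) ⊗_A F` of degree `γ`. -/
noncomputable def boundaries (R : GradedFreeResolution.{u, v, w} 𝒜 𝔪) (i : ℕ) (γ : Γ) :
    Submodule k (R.Tensored i) :=
  (R.tensorComponent (i + 1) γ).map (R.tensorDiff i)

/-- `Tor^A_i(A ⧸ 𝔪, A ⧸ 𝔪)_γ`, the degree-`γ` part of the homology `H_i((A ⧸ 𝔪) ⊗_A F)`:
cycles modulo boundaries, realized as the image of the cycles in the quotient of
`(A ⧸ 𝔪) ⊗_A F_i` by the boundaries (every boundary is a cycle). -/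
abbrev Tor (R : GradedFreeResolution.{u, v, w} 𝒜 𝔪) (i : ℕ) (γ : Γ) : Type (max u v) :=
  ↥((R.cycles i γ).map (R.boundaries i γ).mkQ)

end GradedFreeResolution

/-- The multigraded Poincaré–Betti series `∑ dim_k Tor^A_i(A ⧸ 𝔪, A ⧸ 𝔪)_α x^α t^i`. -/
noncomputable def poincareSeries {n : ℕ} {𝒜 : (Fin n →₀ ℕ) → Submodule k A} {𝔪 : Ideal A}
    (R : GradedFreeResolution.{u, v, 0} 𝒜 𝔪) : PowerSeries (MvPowerSeries (Fin n) ℕ) :=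
  PowerSeries.mk fun i => fun α => Module.finrank k (R.Tor i α)

end GradedTor

/-! ### The algebra `A = S / a` -/

section Quotient

variable {k : Type u} [Field k] {n : ℕ} {Γ : Type w} [AddCommMonoid Γ]

/-- `a` is homogeneous for the grading `deg x_i = d i` of the polynomial ring by `Γ`. -/
def IsHomogeneousFor (d : Fin n → Γ) (a : Ideal (MvPolynomial (Fin n) k)) : Prop :=
  ∀ f ∈ a, ∀ γ : Γ, weightedHomogeneousComponent d γ f ∈ a

/-- The natural multigrading `deg x_i = e_i ∈ ℕ^n`. -/
noncomputable def naturalDegree (n : ℕ) : Fin n → (Fin n →₀ ℕ) :=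
  fun i => Finsupp.single i 1

/-- The degree-`γ` part of `A = S / a`, for the grading `deg x_i = d i`. -/
noncomputable def algComponent (d : Fin n → Γ) (a : Ideal (MvPolynomial (Fin n) k)) (γ : Γ) :
    Submodule k (MvPolynomial (Fin n) k ⧸ a) :=
  (weightedHomogeneousSubmodule k d γ).map (Ideal.Quotient.mkₐ k a).toLinearMap

/-- The ideal of `A = S / a` generated by the residue classes of the variables. The residue class
field is `A ⧸ augIdeal a`, which is `k` if `a ⊆ ⟨x_0, …, x_{n-1}⟩`. -/
noncomputable def augIdeal (a : Ideal (MvPolynomial (Fin n) k)) :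
    Ideal (MvPolynomial (Fin n) k ⧸ a) :=
  (idealOfVars (Fin n) k).map (Ideal.Quotient.mk a)

end Quotient

end AnickCommutative

namespace AnickCommutative

/-! ### Residue classes of monomials -/

section ResidueMonomials

variable {k : Type u} [Field k] {n : ℕ} {Γ : Type w} [AddCommMonoid Γ]
  {a : Ideal (MvPolynomial (Fin n) k)}

/-! Graded free resolutions of the same module are homotopy equivalent by maps of degree `0`. So for
one fixed graded free resolution `P`, the degree-`γ` part of `Tor_i` is no larger than that of `(A ⧸
𝔪) ⊗ P_i` (`GradedFreeResolution.finrank_tor_le`), which is spanned by the basis elements of degree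
`γ`. Minimality is not needed: it suffices to find a resolution whose basis is counted by
`boundSeries`.

Such a resolution is built in the style of Schreyer, over the basis of `A` formed by irreducible
monomials. The basis of `F_i` consists of cells, words of `i` monomials in which the admissible next
letters depend on the word so far. Each cell has a colon set, starting with all monomials `≠ 1` for
the empty cell. The axioms of `LetterSystem` say that the letters after a cell lie in its colon set
and that each irreducible element of that set is divisible by one of them. Taking the dividing
letter of highest priority, every such element factors uniquely as a letter times a monomial outside
the colon set of the longer cell (`Cell.exists_factor`, `Cell.factor_unique`). Hence a differential
whose leading terms send a cell to its last letter times its parent is injective on the span of the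
monomials outside the colon sets (`IsLeading.injOn`), and its image together with the corresponding
span in `F_i` fills `F_i` (`monomialSpan_le_sup`). With `D ∘ D = 0` this gives exactness, and the
version with control of the order gives the corrections needed to construct the next differential
(`exists_next`). Only monomials of equal weight are comparable, so homogeneity comes for free.

For the initial ideal of `a`, cells are concatenations of blocks, each a variable or a minimal fully
attached tuple. The two attaching conditions mirror the two ways of lying in a colon set, which is
why the axioms hold (`attachedLetters_subset_colonSet`, `exists_attachedLetter_le`). Along a cell
the first entries of the blocks never decrease, and a one-variable block is strictly smaller than
all later heads. So a cell is determined by the set of its one-variable blocks and the word formed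
by the other blocks (`cell_eq_of_cellWord_eq`). The set accounts for `∏ (1 + x_i t)` and the word
for `F`. -/

theorem add_mem_initialMonomials {w : Fin n →₀ ℕ} (hw : w ∈ initialMonomials a)
    (v : Fin n →₀ ℕ) : w + v ∈ initialMonomials a := by
  classical
  obtain ⟨f, hf, h0, rfl⟩ := hw
  have hm : (monomial v (1 : k)) ≠ 0 := by simp
  refine ⟨f * monomial v 1, a.mul_mem_right _ hf, mul_ne_zero h0 hm, ?_⟩
  rw [MonomialOrder.degree_mul h0 hm, MonomialOrder.degree_monomial]
  simp

theorem mem_initialMonomials_of_le {w v : Fin n →₀ ℕ} (hw : w ∈ initialMonomials a)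
    (h : w ≤ v) : v ∈ initialMonomials a := by
  obtain ⟨u, rfl⟩ := exists_add_of_le h
  exact add_mem_initialMonomials hw u

theorem coeff_zero_of_mem_idealOfVars {f : MvPolynomial (Fin n) k}
    (hf : f ∈ idealOfVars (Fin n) k) : coeff 0 f = 0 := by
  have h : idealOfVars (Fin n) k ≤ RingHom.ker (constantCoeff (σ := Fin n) (R := k)) := by
    refine Ideal.span_le.2 ?_
    rintro _ ⟨i, rfl⟩
    simp [RingHom.mem_ker]
  simpa [RingHom.mem_ker, constantCoeff_eq] using h hf

/-- The residue class of a monomial in the quotient algebra. -/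
noncomputable def residueMonomial (a : Ideal (MvPolynomial (Fin n) k)) (w : Fin n →₀ ℕ) :
    MvPolynomial (Fin n) k ⧸ a :=
  Ideal.Quotient.mk a (monomial w 1)

theorem residueMonomial_add (v w : Fin n →₀ ℕ) :
    residueMonomial a (v + w) = residueMonomial a v * residueMonomial a w := by
  simp [residueMonomial, ← map_mul, monomial_mul]

theorem residueMonomial_zero : residueMonomial a 0 = 1 := by
  simp [residueMonomial]

theorem mk_eq_sum (f : MvPolynomial (Fin n) k) :
    Ideal.Quotient.mk a f = ∑ v ∈ f.support, coeff v f • residueMonomial a v := by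
  conv_lhs => rw [f.as_sum]
  rw [map_sum]
  refine Finset.sum_congr rfl fun v _ => ?_
  rw [residueMonomial, ← Ideal.Quotient.mkₐ_eq_mk k, ← map_smul, smul_monomial, smul_eq_mul,
    mul_one]

theorem span_range_residueMonomial :
    Submodule.span k (Set.range (residueMonomial a)) = ⊤ := by
  refine eq_top_iff.2 fun x _ => ?_
  obtain ⟨f, rfl⟩ := Ideal.Quotient.mk_surjective x
  rw [mk_eq_sum]
  exact Submodule.sum_mem _ fun v _ => Submodule.smul_mem _ _ (Submodule.subset_span ⟨v, rfl⟩)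

theorem residueMonomial_mem_algComponent (d : Fin n → Γ) (w : Fin n →₀ ℕ) :
    residueMonomial a w ∈ algComponent d a (Finsupp.weight d w) :=
  ⟨monomial w 1, isWeightedHomogeneous_monomial d w 1 rfl, rfl⟩

/-- If `w` is the leading monomial of `f ∈ a`, the homogeneous component of `f` of the weight of `w`
is again in `a` and still has leading monomial `w`. Solving for `w` gives the claim. -/
theorem residueMonomial_mem_span_lt {d : Fin n → Γ} (hd : IsHomogeneousFor d a)
    {w : Fin n →₀ ℕ} (hw : w ∈ initialMonomials a) :
    residueMonomial a w ∈ Submodule.span k (residueMonomial a ''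
      {v | v ≺[MonomialOrder.degLex] w ∧ Finsupp.weight d v = Finsupp.weight d w}) := by
  classical
  obtain ⟨f, hf, h0, rfl⟩ := hw
  set w := MonomialOrder.degLex.degree f with hw
  set g := weightedHomogeneousComponent d (Finsupp.weight d w) f with hg
  have hcw : coeff w g ≠ 0 := by
    rw [hg, coeff_weightedHomogeneousComponent, if_pos rfl]
    exact MonomialOrder.coeff_degree_ne_zero_iff.2 h0
  have hmk : Ideal.Quotient.mk a g = 0 := Ideal.Quotient.eq_zero_iff_mem.2 (hd f hf _)
  rw [mk_eq_sum, ← Finset.add_sum_erase _ _ (mem_support_iff.2 hcw)] at hmk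
  have h1 : residueMonomial a w =
      -((coeff w g)⁻¹ • ∑ v ∈ g.support.erase w, coeff v g • residueMonomial a v) := by
    rw [← sub_eq_zero, sub_neg_eq_add, ← smul_zero (coeff w g)⁻¹, ← hmk, smul_add, smul_smul,
      inv_mul_cancel₀ hcw, one_smul]
  rw [h1]
  refine Submodule.neg_mem _ (Submodule.smul_mem _ _ (Submodule.sum_mem _ fun v hv =>
    Submodule.smul_mem _ _ (Submodule.subset_span ⟨v, ?_, rfl⟩)))
  obtain ⟨hne, hv⟩ := Finset.mem_erase.1 hv
  rw [mem_support_iff, hg, coeff_weightedHomogeneousComponent] at hv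
  split_ifs at hv with h2
  · refine ⟨lt_of_le_of_ne (MonomialOrder.le_degree (mem_support_iff.2 hv)) ?_, h2⟩
    exact fun h => hne (MonomialOrder.degLex.toSyn.injective h)
  · exact absurd rfl hv

theorem residueMonomial_mem_span_irreducible {d : Fin n → Γ} (hd : IsHomogeneousFor d a)
    (w : Fin n →₀ ℕ) :
    residueMonomial a w ∈ Submodule.span k (residueMonomial a ''
      {v | v ∉ initialMonomials a ∧ (v = w ∨ v ≺[MonomialOrder.degLex] w ∧
        Finsupp.weight d v = Finsupp.weight d w)}) := by
  -- The order on exponent vectors themselves is divisibility; well-founded induction for degree-lex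
  -- has to run in `degLex.syn`.
  have key : ∀ s : MonomialOrder.degLex.syn, ∀ w : Fin n →₀ ℕ, MonomialOrder.degLex.toSyn w = s →
      residueMonomial a w ∈ Submodule.span k (residueMonomial a ''
      {v | v ∉ initialMonomials a ∧ (v = w ∨ v ≺[MonomialOrder.degLex] w ∧
        Finsupp.weight d v = Finsupp.weight d w)}) := by
    intro s
    induction s using WellFoundedLT.induction with
    | ind s ih =>
      rintro w rfl
      by_cases hw : w ∈ initialMonomials a
      · refine (Submodule.span_le.2 ?_) (residueMonomial_mem_span_lt hd hw)
        rintro _ ⟨v, ⟨hv, hvw⟩, rfl⟩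
        refine Submodule.span_mono (Set.image_mono ?_) (ih _ hv v rfl)
        rintro u ⟨hu, rfl | ⟨h1, h2⟩⟩
        · exact ⟨hu, Or.inr ⟨hv, hvw⟩⟩
        · exact ⟨hu, Or.inr ⟨h1.trans hv, h2.trans hvw⟩⟩
      · exact Submodule.subset_span ⟨w, ⟨hw, Or.inl rfl⟩, rfl⟩
  exact key _ w rfl

/-- A nontrivial relation would lift to a nonzero element of `a` supported on irreducible monomials,
but its leading monomial is reducible. -/
theorem linearIndependent_residueMonomial :
    LinearIndependent k fun v : {v // v ∉ initialMonomials a} => residueMonomial a v := by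
  classical
  rw [linearIndependent_iff']
  intro s g hg i hi
  by_contra hne
  set f : MvPolynomial (Fin n) k := ∑ v ∈ s, monomial v.1 (g v) with hf
  have hc : ∀ u, coeff u f = ∑ v ∈ s, if v.1 = u then g v else 0 := fun u => by
    simp [hf, coeff_sum, coeff_monomial]
  have hci : coeff i.1 f = g i := by
    rw [hc]
    rw [Finset.sum_eq_single i (fun b _ hb => if_neg fun h => hb (Subtype.ext h))
      (fun h => absurd hi h), if_pos rfl]
  have h0 : f ≠ 0 := fun h => hne (by rw [← hci, h, coeff_zero])
  have hmem : f ∈ a := by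
    rw [← Ideal.Quotient.eq_zero_iff_mem, ← hg, hf, map_sum]
    refine Finset.sum_congr rfl fun v _ => ?_
    rw [residueMonomial, ← Ideal.Quotient.mkₐ_eq_mk k, ← map_smul, smul_monomial, smul_eq_mul,
      mul_one]
  have hd := MonomialOrder.coeff_degree_ne_zero_iff (m := MonomialOrder.degLex) (f := f) |>.2 h0
  have hin : MonomialOrder.degLex.degree f ∈ initialMonomials a := ⟨f, hmem, h0, rfl⟩
  rw [hc] at hd
  refine hd (Finset.sum_eq_zero fun v _ => if_neg fun h => v.2 ?_)
  rw [h]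
  exact hin

/-- Makes the graded reduction lemmas available for an arbitrary ideal. -/
theorem IsHomogeneousFor.trivial (a : Ideal (MvPolynomial (Fin n) k)) :
    IsHomogeneousFor (fun _ => ()) a := by
  intro f hf γ
  have : weightedHomogeneousComponent (fun _ : Fin n => ()) γ f = f := by
    classical
    ext v
    rw [coeff_weightedHomogeneousComponent, if_pos (Subsingleton.elim _ _)]
  rwa [this]

theorem span_irreducible :
    Submodule.span k (Set.range fun v : {v // v ∉ initialMonomials a} => residueMonomial a v)
      = ⊤ := by
  rw [eq_top_iff, ← span_range_residueMonomial, Submodule.span_le]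
  rintro _ ⟨w, rfl⟩
  refine Submodule.span_mono ?_
    (residueMonomial_mem_span_irreducible (IsHomogeneousFor.trivial a) w)
  rintro _ ⟨v, ⟨hv, -⟩, rfl⟩
  exact ⟨⟨v, hv⟩, rfl⟩

/-- The basis of the quotient algebra given by the irreducible monomials. -/
noncomputable def irreducibleBasis (a : Ideal (MvPolynomial (Fin n) k)) :
    Module.Basis {v // v ∉ initialMonomials a} k (MvPolynomial (Fin n) k ⧸ a) :=
  Module.Basis.mk linearIndependent_residueMonomial span_irreducible.ge

theorem irreducibleBasis_apply (v : {v // v ∉ initialMonomials a}) :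
    irreducibleBasis a v = residueMonomial a v :=
  Module.Basis.mk_apply _ _ _

theorem coord_residueMonomial_self (v : {v // v ∉ initialMonomials a}) :
    (irreducibleBasis a).coord v (residueMonomial a v) = 1 := by
  rw [← irreducibleBasis_apply, Module.Basis.coord_apply, Module.Basis.repr_self,
    Finsupp.single_eq_same]

/-- The normal form of `w` lies in the span given by `residueMonomial_mem_span_irreducible`, on
which all other coordinates vanish. -/
theorem eq_or_lt_of_coord_ne_zero {d : Fin n → Γ} (hd : IsHomogeneousFor d a)
    (v : {v // v ∉ initialMonomials a}) (w : Fin n →₀ ℕ)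
    (h : (irreducibleBasis a).coord v (residueMonomial a w) ≠ 0) :
    v.1 = w ∨ v.1 ≺[MonomialOrder.degLex] w ∧ Finsupp.weight d v.1 = Finsupp.weight d w := by
  by_contra hc
  refine h ?_
  have h1 : Submodule.span k (residueMonomial a ''
      {v | v ∉ initialMonomials a ∧ (v = w ∨ v ≺[MonomialOrder.degLex] w ∧
        Finsupp.weight d v = Finsupp.weight d w)}) ≤
      LinearMap.ker ((irreducibleBasis a).coord v) := by
    refine Submodule.span_le.2 ?_
    rintro _ ⟨u, ⟨hu, hu'⟩, rfl⟩
    have : (⟨u, hu⟩ : {v // v ∉ initialMonomials a}) ≠ v := by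
      rintro rfl
      exact hc hu'
    rw [SetLike.mem_coe, LinearMap.mem_ker, show u = (⟨u, hu⟩ : {v // v ∉ initialMonomials a}).1
      from rfl, ← irreducibleBasis_apply, Module.Basis.coord_apply, Module.Basis.repr_self,
      Finsupp.single_eq_of_ne this.symm]
  exact h1 (residueMonomial_mem_span_irreducible hd w)

end ResidueMonomials


/-! ### Decomposition of graded free modules -/

section Decomposition

variable {k : Type u} [Field k] {A : Type u} [CommRing A] [Algebra k A]
  {Γ : Type w} [AddCommMonoid Γ]

/-- The grading data of a graded algebra, with the decomposition into homogeneous components given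
by a `k`-linear map. -/
structure AlgebraGrading (𝒜 : Γ → Submodule k A) where
  /-- the decomposition into homogeneous components -/
  decomp : A →ₗ[k] (Γ →₀ A)
  decomp_of_mem : ∀ {γ r}, r ∈ 𝒜 γ → decomp r = Finsupp.single γ r
  decomp_mem : ∀ r γ, decomp r γ ∈ 𝒜 γ
  sum_decomp : ∀ r, (decomp r).sum (fun _ x => x) = r
  mul_mem : ∀ {δ ε r s}, r ∈ 𝒜 δ → s ∈ 𝒜 ε → r * s ∈ 𝒜 (δ + ε)
  one_mem : (1 : A) ∈ 𝒜 0

variable {𝒜 : Γ → Submodule k A}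

theorem single_mem_freeComponent {ι : Type*} (deg : ι → Γ) (b : ι) {δ : Γ} {r : A}
    (hr : r ∈ 𝒜 δ) : Finsupp.single b r ∈ freeComponent 𝒜 deg (δ + deg b) :=
  Submodule.subset_span ⟨b, δ, r, hr, rfl, rfl⟩

namespace AlgebraGrading

variable (G : AlgebraGrading 𝒜)
include G

theorem smul_mem_freeComponent {ι : Type*} (deg : ι → Γ) {δ γ : Γ} {r : A} {x : ι →₀ A}
    (hr : r ∈ 𝒜 δ) (hx : x ∈ freeComponent 𝒜 deg γ) :
    r • x ∈ freeComponent 𝒜 deg (δ + γ) := by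
  induction hx using Submodule.span_induction with
  | mem x hx =>
    obtain ⟨b, ε, s, hs, rfl, rfl⟩ := hx
    rw [Finsupp.smul_single, smul_eq_mul, ← add_assoc]
    exact single_mem_freeComponent deg b (G.mul_mem hr hs)
  | zero => rw [smul_zero]; exact Submodule.zero_mem _
  | add x y _ _ hx hy => rw [smul_add]; exact Submodule.add_mem _ hx hy
  | smul c x _ hx => rw [smul_comm]; exact Submodule.smul_mem _ _ hx

theorem basis_mem_freeComponent {ι : Type*} (deg : ι → Γ) (b : ι) :
    Finsupp.single b (1 : A) ∈ freeComponent 𝒜 deg (deg b) := by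
  simpa using single_mem_freeComponent (𝒜 := 𝒜) deg b G.one_mem

theorem map_mem_freeComponent {ι κ : Type*} (deg : ι → Γ) (deg' : κ → Γ)
    (f : (ι →₀ A) →ₗ[A] (κ →₀ A))
    (hf : ∀ b, f (Finsupp.single b 1) ∈ freeComponent 𝒜 deg' (deg b)) (γ : Γ) (x : ι →₀ A)
    (hx : x ∈ freeComponent 𝒜 deg γ) : f x ∈ freeComponent 𝒜 deg' γ := by
  induction hx using Submodule.span_induction with
  | mem x hx =>
    obtain ⟨b, ε, s, hs, rfl, rfl⟩ := hx
    have : Finsupp.single b s = s • Finsupp.single b (1 : A) := by simp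
    rw [this, map_smul]
    exact G.smul_mem_freeComponent deg' hs (hf b)
  | zero => rw [map_zero]; exact Submodule.zero_mem _
  | add x y _ _ hx hy => rw [map_add]; exact Submodule.add_mem _ hx hy
  | smul c x _ hx =>
    rw [LinearMap.map_smul_of_tower]; exact Submodule.smul_mem _ _ hx

/-- The decomposition of a graded free module into homogeneous components. -/
noncomputable def freeDecomp {ι : Type*} (deg : ι → Γ) : (ι →₀ A) →ₗ[k] (Γ →₀ (ι →₀ A)) :=
  Finsupp.lsum k fun b =>
    (Finsupp.lsum k fun δ => (Finsupp.lsingle (δ + deg b)).comp (Finsupp.lsingle b)).comp G.decomp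

theorem freeDecomp_single {ι : Type*} (deg : ι → Γ) (b : ι) (r : A) :
    G.freeDecomp deg (Finsupp.single b r) = ∑ δ ∈ (G.decomp r).support,
      Finsupp.single (δ + deg b) (Finsupp.single b (G.decomp r δ)) := by
  rw [freeDecomp, Finsupp.lsum_single, LinearMap.comp_apply, Finsupp.lsum_apply, Finsupp.sum]
  rfl

theorem freeDecomp_of_mem {ι : Type*} (deg : ι → Γ) {γ : Γ} {x : ι →₀ A}
    (hx : x ∈ freeComponent 𝒜 deg γ) : G.freeDecomp deg x = Finsupp.single γ x := by
  induction hx using Submodule.span_induction with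
  | mem x hx =>
    obtain ⟨b, ε, s, hs, rfl, rfl⟩ := hx
    simp [freeDecomp, G.decomp_of_mem hs]
  | zero => simp
  | add x y _ _ hx hy => rw [map_add, hx, hy, Finsupp.single_add]
  | smul c x _ hx => rw [map_smul, hx, Finsupp.smul_single]

theorem freeDecomp_mem {ι : Type*} (deg : ι → Γ) (x : ι →₀ A) (γ : Γ) :
    G.freeDecomp deg x γ ∈ freeComponent 𝒜 deg γ := by
  induction x using Finsupp.induction_linear with
  | zero => simp
  | add x y hx hy => rw [map_add]; exact Submodule.add_mem _ hx hy
  | single b r =>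
    rw [freeDecomp_single, Finsupp.finsetSum_apply]
    refine Submodule.sum_mem _ fun δ _ => ?_
    by_cases h : δ + deg b = γ
    · subst h
      rw [Finsupp.single_eq_same]
      exact single_mem_freeComponent deg b (G.decomp_mem r δ)
    · rw [Finsupp.single_eq_of_ne (Ne.symm h)]
      exact Submodule.zero_mem _

theorem sum_freeDecomp {ι : Type*} (deg : ι → Γ) (x : ι →₀ A) :
    (G.freeDecomp deg x).sum (fun _ y => y) = x := by
  have h : (Finsupp.lsum k fun _ : Γ => (LinearMap.id : (ι →₀ A) →ₗ[k] (ι →₀ A))).comp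
      (G.freeDecomp deg) = LinearMap.id := by
    ext b r : 2
    conv_rhs => rw [LinearMap.comp_apply, LinearMap.id_apply, Finsupp.lsingle_apply,
      ← G.sum_decomp r]
    rw [LinearMap.comp_apply, LinearMap.comp_apply, Finsupp.lsingle_apply, freeDecomp_single,
      map_sum, Finsupp.sum, Finsupp.single_finsetSum]
    simp
  have := LinearMap.congr_fun h x
  rwa [LinearMap.comp_apply, Finsupp.lsum_apply] at this

/-- Maps of degree `0` commute with projection to homogeneous components. This is what turns
arbitrary preimages into homogeneous ones. -/
theorem freeDecomp_map {ι κ : Type*} (deg : ι → Γ) (deg' : κ → Γ)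
    (f : (ι →₀ A) →ₗ[A] (κ →₀ A))
    (hf : ∀ γ, ∀ x ∈ freeComponent 𝒜 deg γ, f x ∈ freeComponent 𝒜 deg' γ) (x : ι →₀ A) (γ : Γ) :
    G.freeDecomp deg' (f x) γ = f (G.freeDecomp deg x γ) := by
  classical
  conv_lhs => rw [← G.sum_freeDecomp deg x]
  rw [Finsupp.sum, map_sum, map_sum, Finsupp.finsetSum_apply]
  have h : ∀ δ, G.freeDecomp deg' (f (G.freeDecomp deg x δ)) =
      Finsupp.single δ (f (G.freeDecomp deg x δ)) := fun δ =>
    G.freeDecomp_of_mem deg' (hf _ _ (G.freeDecomp_mem deg x δ))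
  simp only [h]
  rw [Finset.sum_eq_single γ]
  · rw [Finsupp.single_eq_same]
  · intro δ _ hδ
    rw [Finsupp.single_eq_of_ne (Ne.symm hδ)]
  · intro hγ
    rw [Finsupp.notMem_support_iff.1 hγ, map_zero, Finsupp.single_eq_same]

end AlgebraGrading

end Decomposition

/-! ### Comparison of graded free resolutions -/

namespace GradedFreeResolution

section Comparison

universe v₁ v₂

variable {k : Type u} [Field k] {A : Type u} [CommRing A] [Algebra k A]
  {Γ : Type w} [AddCommMonoid Γ] {𝒜 : Γ → Submodule k A} {𝔪 : Ideal A}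
  (G : AlgebraGrading 𝒜)

/-- A map of degree `0` between graded free modules. -/
def IsHomogeneousMap (𝒜 : Γ → Submodule k A) {ι : Type v₁} {κ : Type v₂} (deg : ι → Γ)
    (deg' : κ → Γ) (f : (ι →₀ A) →ₗ[A] (κ →₀ A)) : Prop :=
  ∀ γ, ∀ x ∈ freeComponent 𝒜 deg γ, f x ∈ freeComponent 𝒜 deg' γ

theorem diff_comp_diff (R : GradedFreeResolution.{u, v₁, w} 𝒜 𝔪) (i : ℕ) (x) :
    R.diff i (R.diff (i + 1) x) = 0 :=
  (R.exact_succ i).apply_apply_eq_zero x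

include G

theorem exists_homogeneous_diff_eq (R : GradedFreeResolution.{u, v₁, w} 𝒜 𝔪) (i : ℕ) {γ : Γ}
    {y : R.basis i →₀ A} (hy : y ∈ freeComponent 𝒜 (R.deg i) γ) (h : ∃ x, R.diff i x = y) :
    ∃ x ∈ freeComponent 𝒜 (R.deg (i + 1)) γ, R.diff i x = y := by
  obtain ⟨x, rfl⟩ := h
  refine ⟨G.freeDecomp _ x γ, G.freeDecomp_mem _ x γ, ?_⟩
  rw [← G.freeDecomp_map _ _ _ (R.diff_homogeneous i), G.freeDecomp_of_mem _ hy,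
    Finsupp.single_eq_same]

theorem exists_homogeneous_aug_eq (R : GradedFreeResolution.{u, v₁, w} 𝒜 𝔪) (y : A ⧸ 𝔪) :
    ∃ x ∈ freeComponent 𝒜 (R.deg 0) 0, R.aug x = y := by
  classical
  obtain ⟨x, rfl⟩ := R.aug_surjective y
  refine ⟨G.freeDecomp _ x 0, G.freeDecomp_mem _ x 0, ?_⟩
  conv_rhs => rw [← G.sum_freeDecomp (R.deg 0) x]
  rw [Finsupp.sum, map_sum, Finset.sum_eq_single 0]
  · exact fun γ _ hγ => R.aug_homogeneous γ hγ _ (G.freeDecomp_mem _ x γ)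
  · intro h
    rw [Finsupp.notMem_support_iff.1 h, map_zero]

theorem exists_lift {ι : Type v₁} (deg : ι → Γ) (R : GradedFreeResolution.{u, v₂, w} 𝒜 𝔪) (i : ℕ)
    (f : (ι →₀ A) →ₗ[A] (R.basis i →₀ A)) (hf : IsHomogeneousMap 𝒜 deg (R.deg i) f)
    (h : ∀ b, ∃ x, R.diff i x = f (Finsupp.single b 1)) :
    ∃ g : (ι →₀ A) →ₗ[A] (R.basis (i + 1) →₀ A),
      IsHomogeneousMap 𝒜 deg (R.deg (i + 1)) g ∧ (R.diff i).comp g = f := by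
  choose g hg hg' using fun b => exists_homogeneous_diff_eq G R i
    (hf _ _ (G.basis_mem_freeComponent deg b)) (h b)
  refine ⟨Finsupp.linearCombination A g, G.map_mem_freeComponent _ _ _ fun b => ?_, ?_⟩
  · simpa using hg b
  · ext b : 2
    simp [hg']

theorem exists_lift_aug (R : GradedFreeResolution.{u, v₁, w} 𝒜 𝔪)
    (P : GradedFreeResolution.{u, v₂, w} 𝒜 𝔪) :
    ∃ g : (R.basis 0 →₀ A) →ₗ[A] (P.basis 0 →₀ A),
      IsHomogeneousMap 𝒜 (R.deg 0) (P.deg 0) g ∧ P.aug.comp g = R.aug := by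
  have h : ∀ b, ∃ x ∈ freeComponent 𝒜 (P.deg 0) (R.deg 0 b),
      P.aug x = R.aug (Finsupp.single b 1) := by
    intro b
    -- A basis element of nonzero degree is killed by the augmentation, so it can be lifted to `0`.
    by_cases hb : R.deg 0 b = 0
    · rw [hb]
      exact exists_homogeneous_aug_eq G P _
    · refine ⟨0, Submodule.zero_mem _, ?_⟩
      rw [map_zero, R.aug_homogeneous _ hb _ (G.basis_mem_freeComponent _ b)]
  choose g hg hg' using h
  refine ⟨Finsupp.linearCombination A g, G.map_mem_freeComponent _ _ _ fun b => ?_, ?_⟩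
  · simpa using hg b
  · ext b : 2
    simp [hg']

theorem exists_chainMap (R : GradedFreeResolution.{u, v₁, w} 𝒜 𝔪)
    (P : GradedFreeResolution.{u, v₂, w} 𝒜 𝔪) :
    ∃ f : ∀ i, (R.basis i →₀ A) →ₗ[A] (P.basis i →₀ A),
      (∀ i, IsHomogeneousMap 𝒜 (R.deg i) (P.deg i) (f i)) ∧ P.aug.comp (f 0) = R.aug ∧
      ∀ i, (P.diff i).comp (f (i + 1)) = (f i).comp (R.diff i) := by
  -- The recursion carries two consecutive maps, because lifting the next one uses the commutative
  -- square between them.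
  let T : ℕ → Type _ := fun i => {p : ((R.basis i →₀ A) →ₗ[A] (P.basis i →₀ A)) ×
      ((R.basis (i + 1) →₀ A) →ₗ[A] (P.basis (i + 1) →₀ A)) //
    IsHomogeneousMap 𝒜 (R.deg i) (P.deg i) p.1 ∧
    IsHomogeneousMap 𝒜 (R.deg (i + 1)) (P.deg (i + 1)) p.2 ∧
    (P.diff i).comp p.2 = p.1.comp (R.diff i)}
  obtain ⟨f₀, hf₀, hf₀'⟩ := exists_lift_aug G R P
  obtain ⟨f₁, hf₁, hf₁'⟩ := exists_lift G (R.deg 1) P 0 (f₀.comp (R.diff 0))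
    (fun γ x hx => hf₀ _ _ (R.diff_homogeneous 0 γ x hx)) (fun b => by
      refine (P.exact_zero _).1 ?_
      rw [← LinearMap.comp_apply, ← LinearMap.comp_assoc, hf₀', LinearMap.comp_apply]
      exact R.exact_zero.apply_apply_eq_zero _)
  have step : ∀ i (p : T i), ∃ q : T (i + 1), q.1.1 = p.1.2 := by
    rintro i ⟨⟨g₀, g₁⟩, h₀, h₁, h⟩
    obtain ⟨g₂, hg₂, hg₂'⟩ := exists_lift G (R.deg (i + 2)) P (i + 1) (g₁.comp (R.diff (i + 1)))
      (fun γ x hx => h₁ _ _ (R.diff_homogeneous (i + 1) γ x hx)) (fun b => by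
        refine (P.exact_succ i _).1 ?_
        have := LinearMap.congr_fun h (R.diff (i + 1) (Finsupp.single b 1))
        simp only [LinearMap.comp_apply] at this ⊢
        rw [this, diff_comp_diff, map_zero])
    exact ⟨⟨(g₁, g₂), h₁, hg₂, hg₂'⟩, rfl⟩
  choose next hnext using step
  let F : ∀ i, T i := fun i => Nat.rec (⟨(f₀, f₁), hf₀, hf₁, hf₁'⟩ : T 0) next i
  refine ⟨fun i => (F i).1.1, fun i => (F i).2.1, hf₀', fun i => ?_⟩
  have h1 : (F (i + 1)).1.1 = (F i).1.2 := hnext i (F i)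
  change _ ∘ₗ (F (i + 1)).1.1 = _
  rw [h1]
  exact (F i).2.2.2

/-- A chain map over the zero map of `A ⧸ 𝔪` is null-homotopic. It is applied to the difference of a
round trip and the identity. -/
theorem exists_homotopy (R : GradedFreeResolution.{u, v₁, w} 𝒜 𝔪)
    (P : GradedFreeResolution.{u, v₂, w} 𝒜 𝔪)
    (f : ∀ i, (R.basis i →₀ A) →ₗ[A] (P.basis i →₀ A))
    (hf : ∀ i, IsHomogeneousMap 𝒜 (R.deg i) (P.deg i) (f i)) (hf₀ : P.aug.comp (f 0) = 0)
    (hfd : ∀ i, (P.diff i).comp (f (i + 1)) = (f i).comp (R.diff i)) :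
    ∃ h : ∀ i, (R.basis i →₀ A) →ₗ[A] (P.basis (i + 1) →₀ A),
      (∀ i, IsHomogeneousMap 𝒜 (R.deg i) (P.deg (i + 1)) (h i)) ∧ (P.diff 0).comp (h 0) = f 0 ∧
      ∀ i, (P.diff (i + 1)).comp (h (i + 1)) = f (i + 1) - (h i).comp (R.diff i) := by
  let T : ℕ → Type _ := fun i => {p : ((R.basis i →₀ A) →ₗ[A] (P.basis (i + 1) →₀ A)) ×
      ((R.basis (i + 1) →₀ A) →ₗ[A] (P.basis (i + 2) →₀ A)) //
    IsHomogeneousMap 𝒜 (R.deg i) (P.deg (i + 1)) p.1 ∧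
    IsHomogeneousMap 𝒜 (R.deg (i + 1)) (P.deg (i + 2)) p.2 ∧
    (P.diff (i + 1)).comp p.2 = f (i + 1) - p.1.comp (R.diff i)}
  obtain ⟨h₀, hh₀, hh₀'⟩ := exists_lift G (R.deg 0) P 0 (f 0) (hf 0) (fun b =>
    (P.exact_zero _).1 (by simpa using LinearMap.congr_fun hf₀ (Finsupp.single b 1)))
  have hom : ∀ i (g : (R.basis i →₀ A) →ₗ[A] (P.basis (i + 1) →₀ A)),
      IsHomogeneousMap 𝒜 (R.deg i) (P.deg (i + 1)) g →
      IsHomogeneousMap 𝒜 (R.deg (i + 1)) (P.deg (i + 1)) (f (i + 1) - g.comp (R.diff i)) :=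
    fun i g hg γ x hx => Submodule.sub_mem _ (hf _ _ _ hx) (hg _ _ (R.diff_homogeneous i γ x hx))
  obtain ⟨h₁, hh₁, hh₁'⟩ := exists_lift G (R.deg 1) P 1 (f 1 - h₀.comp (R.diff 0)) (hom 0 h₀ hh₀)
    (fun b => by
      refine (P.exact_succ 0 _).1 ?_
      have h1 := LinearMap.congr_fun (hfd 0) (Finsupp.single b 1)
      have h2 := LinearMap.congr_fun hh₀' (R.diff 0 (Finsupp.single b 1))
      simp only [LinearMap.comp_apply, LinearMap.sub_apply, map_sub] at h1 h2 ⊢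
      rw [h1, h2, sub_self])
  have step : ∀ i (p : T i), ∃ q : T (i + 1), q.1.1 = p.1.2 := by
    rintro i ⟨⟨g₀, g₁⟩, hg₀, hg₁, hg⟩
    obtain ⟨g₂, hg₂, hg₂'⟩ := exists_lift G (R.deg (i + 2)) P (i + 2)
      (f (i + 2) - g₁.comp (R.diff (i + 1))) (hom (i + 1) g₁ hg₁) (fun b => by
        refine (P.exact_succ (i + 1) _).1 ?_
        have h1 := LinearMap.congr_fun (hfd (i + 1)) (Finsupp.single b 1)
        have h2 := LinearMap.congr_fun hg (R.diff (i + 1) (Finsupp.single b 1))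
        simp only [LinearMap.comp_apply, LinearMap.sub_apply, map_sub] at h1 h2 ⊢
        rw [h1, h2, diff_comp_diff, map_zero, sub_zero, sub_self])
    exact ⟨⟨(g₁, g₂), hg₁, hg₂, hg₂'⟩, rfl⟩
  choose next hnext using step
  let F : ∀ i, T i := fun i => Nat.rec (⟨(h₀, h₁), hh₀, hh₁, hh₁'⟩ : T 0) next i
  refine ⟨fun i => (F i).1.1, fun i => (F i).2.1, hh₀', fun i => ?_⟩
  have h1 : (F (i + 1)).1.1 = (F i).1.2 := hnext i (F i)
  change _ ∘ₗ (F (i + 1)).1.1 = _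
  rw [h1]
  exact (F i).2.2.2

/-- The dimension of `Tor` is bounded by that of the corresponding component of the complex
`(A ⧸ 𝔪) ⊗_A P`, for every graded free resolution `P`. -/
theorem finrank_tor_le (R : GradedFreeResolution.{u, v₁, w} 𝒜 𝔪)
    (P : GradedFreeResolution.{u, v₂, w} 𝒜 𝔪) (i : ℕ) (γ : Γ)
    [Module.Finite k (P.tensorComponent i γ)] :
    Module.Finite k (R.Tor i γ) ∧
      Module.finrank k (R.Tor i γ) ≤ Module.finrank k (P.tensorComponent i γ) := by
  obtain ⟨f, hf, hf₀, hfd⟩ := exists_chainMap G R P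
  obtain ⟨g, hg, hg₀, hgd⟩ := exists_chainMap G P R
  obtain ⟨h, hh, hh₀, hhd⟩ := exists_homotopy G R R (fun i => (g i).comp (f i) - LinearMap.id)
    (fun i γ x hx => Submodule.sub_mem _ (hg _ _ _ (hf _ _ _ hx)) hx)
    (by rw [LinearMap.comp_sub, ← LinearMap.comp_assoc, hg₀, hf₀, LinearMap.comp_id, sub_self])
    (fun i => by
      rw [LinearMap.comp_sub, ← LinearMap.comp_assoc, hgd, LinearMap.comp_assoc, hfd,
        LinearMap.sub_comp, LinearMap.comp_assoc, LinearMap.comp_id, LinearMap.id_comp])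
  -- Since `g f - 1 = d h + h d`, a cycle and its image under the round trip through `P` differ by a
  -- boundary.
  have key : ∀ x ∈ freeComponent 𝒜 (R.deg i) γ,
      (1 : A ⧸ 𝔪) ⊗ₜ[A] x ∈ R.cycles i γ →
      (1 : A ⧸ 𝔪) ⊗ₜ[A] (g i (f i x)) - (1 : A ⧸ 𝔪) ⊗ₜ[A] x ∈ R.boundaries i γ := by
    intro x hx hc
    refine ⟨(1 : A ⧸ 𝔪) ⊗ₜ[A] (h i x), ⟨h i x, hh _ _ _ hx, rfl⟩, ?_⟩
    change (1 : A ⧸ 𝔪) ⊗ₜ[A] (R.diff i (h i x)) = _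
    cases i with
    | zero =>
      have := LinearMap.congr_fun hh₀ x
      simp only [LinearMap.comp_apply, LinearMap.sub_apply, LinearMap.id_apply] at this
      rw [this, TensorProduct.tmul_sub]
    | succ i =>
      have := LinearMap.congr_fun (hhd i) x
      simp only [LinearMap.comp_apply, LinearMap.sub_apply, LinearMap.id_apply] at this
      rw [this, TensorProduct.tmul_sub, TensorProduct.tmul_sub]
      -- The element `x` need not be a cycle before tensoring. Only `1 ⊗ d x` vanishes, and applying
      -- `h` to it kills the term `1 ⊗ h d x`.
      have h2 : (1 : A ⧸ 𝔪) ⊗ₜ[A] (R.diff i x) = 0 := hc.2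
      have h3 := congrArg ((h i).lTensor (A ⧸ 𝔪)) h2
      rw [LinearMap.lTensor_tmul, map_zero] at h3
      rw [h3, sub_zero]
  set Φ : P.Tensored i →ₗ[k] (R.Tensored i ⧸ R.boundaries i γ) :=
    (R.boundaries i γ).mkQ.comp (((g i).lTensor (A ⧸ 𝔪)).restrictScalars k) with hΦ
  -- Every homology class is thus represented by an element coming from `(A ⧸ 𝔪) ⊗ P`; the
  -- differential of `P` plays no role here.
  have hle : (R.cycles i γ).map (R.boundaries i γ).mkQ ≤ (P.tensorComponent i γ).map Φ := by
    rintro _ ⟨z, hz, rfl⟩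
    have hz' : z ∈ R.tensorComponent i γ := by
      cases i with
      | zero => exact hz
      | succ i => exact hz.1
    obtain ⟨x, hx, rfl⟩ := hz'
    refine ⟨(1 : A ⧸ 𝔪) ⊗ₜ[A] (f i x), ⟨f i x, hf _ _ _ hx, rfl⟩, ?_⟩
    exact (Submodule.Quotient.eq _).2 (key x hx hz)
  have : Module.Finite k ((P.tensorComponent i γ).map Φ) := inferInstance
  exact ⟨Submodule.finiteDimensional_of_le hle,
    (Submodule.finrank_mono hle).trans (Submodule.finrank_map_le _ _)⟩

end Comparison

end GradedFreeResolution


/-! ### The grading of the quotient algebra -/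

section QuotientGrading

variable {k : Type u} [Field k] {n : ℕ} {Γ : Type w} [AddCommMonoid Γ]
  {a : Ideal (MvPolynomial (Fin n) k)} {d : Fin n → Γ}

/-- Reduction to irreducible monomials preserves the weight. -/
theorem algComponent_le_span (hd : IsHomogeneousFor d a) (γ : Γ) :
    algComponent d a γ ≤ Submodule.span k (residueMonomial a ''
      {v | v ∉ initialMonomials a ∧ Finsupp.weight d v = γ}) := by
  rintro _ ⟨f, hf, rfl⟩
  change Ideal.Quotient.mk a f ∈ _
  rw [mk_eq_sum]
  refine Submodule.sum_mem _ fun w hw => Submodule.smul_mem _ _ ?_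
  have hγ : Finsupp.weight d w = γ := hf (mem_support_iff.1 hw)
  refine Submodule.span_mono (Set.image_mono ?_) (residueMonomial_mem_span_irreducible hd w)
  rintro v ⟨hv, rfl | ⟨-, h⟩⟩
  · exact ⟨hv, hγ⟩
  · exact ⟨hv, h.trans hγ⟩

/-- The decomposition of the quotient by a homogeneous ideal into homogeneous components. -/
noncomputable def algDecomp (d : Fin n → Γ) (a : Ideal (MvPolynomial (Fin n) k)) :
    (MvPolynomial (Fin n) k ⧸ a) →ₗ[k] (Γ →₀ (MvPolynomial (Fin n) k ⧸ a)) :=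
  (irreducibleBasis a).constr k fun v =>
    Finsupp.single (Finsupp.weight d v.1) (residueMonomial a v.1)

theorem algDecomp_residueMonomial (v : {v // v ∉ initialMonomials a}) :
    algDecomp d a (residueMonomial a v.1) =
      Finsupp.single (Finsupp.weight d v.1) (residueMonomial a v.1) := by
  rw [algDecomp, ← irreducibleBasis_apply, Module.Basis.constr_basis, irreducibleBasis_apply]

/-- The grading of the quotient by a homogeneous ideal. -/
noncomputable def algGrading (hd : IsHomogeneousFor d a) : AlgebraGrading (algComponent d a) where
  decomp := algDecomp d a
  decomp_of_mem {γ r} hr := by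
    have h := algComponent_le_span hd γ hr
    induction h using Submodule.span_induction with
    | mem x hx =>
      obtain ⟨v, ⟨hv, rfl⟩, rfl⟩ := hx
      exact algDecomp_residueMonomial ⟨v, hv⟩
    | zero => simp
    | add x y hx hy ihx ihy =>
      have hle : Submodule.span k (residueMonomial a ''
          {v | v ∉ initialMonomials a ∧ Finsupp.weight d v = γ}) ≤ algComponent d a γ := by
        refine Submodule.span_le.2 ?_
        rintro _ ⟨v, ⟨hv, rfl⟩, rfl⟩
        exact residueMonomial_mem_algComponent d v
      rw [map_add, ihx (hle hx), ihy (hle hy), Finsupp.single_add]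
    | smul c x hx ih =>
      have hle : Submodule.span k (residueMonomial a ''
          {v | v ∉ initialMonomials a ∧ Finsupp.weight d v = γ}) ≤ algComponent d a γ := by
        refine Submodule.span_le.2 ?_
        rintro _ ⟨v, ⟨hv, rfl⟩, rfl⟩
        exact residueMonomial_mem_algComponent d v
      rw [map_smul, ih (hle hx), Finsupp.smul_single]
  decomp_mem r γ := by
    have hr : r ∈ Submodule.span k
        (Set.range fun v : {v // v ∉ initialMonomials a} => residueMonomial a v) := by
      rw [span_irreducible]; trivial
    induction hr using Submodule.span_induction with
    | mem x hx =>
      obtain ⟨v, rfl⟩ := hx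
      simp only [algDecomp_residueMonomial]
      by_cases h : Finsupp.weight d v.1 = γ
      · rw [h, Finsupp.single_eq_same, ← h]
        exact residueMonomial_mem_algComponent d v.1
      · rw [Finsupp.single_eq_of_ne (Ne.symm h)]
        exact Submodule.zero_mem _
    | zero => simp
    | add x y _ _ hx hy => rw [map_add]; exact Submodule.add_mem _ hx hy
    | smul c x _ hx => rw [map_smul]; exact Submodule.smul_mem _ _ hx
  sum_decomp r := by
    have h : (Finsupp.lsum k fun _ : Γ => (LinearMap.id :
        (MvPolynomial (Fin n) k ⧸ a) →ₗ[k] (MvPolynomial (Fin n) k ⧸ a))).comp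
        (algDecomp d a) = LinearMap.id := by
      refine (irreducibleBasis a).ext fun v => ?_
      rw [irreducibleBasis_apply, LinearMap.comp_apply, algDecomp_residueMonomial,
        Finsupp.lsum_single]
    have := LinearMap.congr_fun h r
    rwa [LinearMap.comp_apply, Finsupp.lsum_apply] at this
  mul_mem := by
    rintro δ ε _ _ ⟨f, hf, rfl⟩ ⟨g, hg, rfl⟩
    exact ⟨f * g, IsWeightedHomogeneous.mul hf hg, by simp⟩
  one_mem := ⟨1, isWeightedHomogeneous_one k d, by simp⟩

end QuotientGrading

/-! ### Cells -/

section Cells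

variable {n : ℕ}

/-- Cells are words of monomials, read from right to left: the last letter is the head. The
letters that can be appended to a cell depend on the cell. -/
def IsCell (letters : List (Fin n →₀ ℕ) → Set (Fin n →₀ ℕ)) : List (Fin n →₀ ℕ) → Prop
  | [] => True
  | u :: c => IsCell letters c ∧ u ∈ letters c

/-- The iterated colon ideals attached to cells: `v` is in the colon ideal of `u :: c` if `u v`
is reducible or divisible by a letter of `c` with priority over `u`. -/
def colonSet (I : Set (Fin n →₀ ℕ)) (letters : List (Fin n →₀ ℕ) → Set (Fin n →₀ ℕ))
    (prior : List (Fin n →₀ ℕ) → (Fin n →₀ ℕ) → (Fin n →₀ ℕ) → Prop) :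
    List (Fin n →₀ ℕ) → Set (Fin n →₀ ℕ)
  | [] => {w | w ≠ 0}
  | u :: c => {v | u + v ∈ I ∨ ∃ u' ∈ letters c, prior c u' u ∧ u' ≤ u + v}

/-- A rule for appending letters, such that the letters generate the colon ideals modulo `I`. -/
structure LetterSystem (I : Set (Fin n →₀ ℕ)) where
  /-- the letters that can be appended to a cell -/
  letters : List (Fin n →₀ ℕ) → Set (Fin n →₀ ℕ)
  /-- the priority of the letters -/
  prior : List (Fin n →₀ ℕ) → (Fin n →₀ ℕ) → (Fin n →₀ ℕ) → Prop
  prior_trans : ∀ {c x y z}, prior c x y → prior c y z → prior c x z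
  prior_irrefl : ∀ c x, ¬ prior c x x
  prior_total : ∀ c x y, prior c x y ∨ x = y ∨ prior c y x
  letters_subset : ∀ c, IsCell letters c → letters c ⊆ colonSet I letters prior c
  exists_letter_le : ∀ c, IsCell letters c → ∀ w ∈ colonSet I letters prior c, w ∉ I →
    ∃ u ∈ letters c, u ≤ w

namespace LetterSystem

variable {I : Set (Fin n →₀ ℕ)} (L : LetterSystem I)

/-- The cells of length `i`. -/
def Cell (i : ℕ) : Type := {c : List (Fin n →₀ ℕ) // IsCell L.letters c ∧ c.length = i}

/-- The colon ideal of a cell. -/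
def colon (c : List (Fin n →₀ ℕ)) : Set (Fin n →₀ ℕ) := colonSet I L.letters L.prior c

/-- The empty cell. -/
def nil : L.Cell 0 := ⟨[], trivial, rfl⟩

variable {L} {i : ℕ}

theorem Cell.eq_nil (c : L.Cell 0) : c = L.nil :=
  Subtype.ext (List.length_eq_zero_iff.1 c.2.2)

theorem Cell.exists_eq_cons (c : L.Cell (i + 1)) :
    ∃ (b : L.Cell i) (u : Fin n →₀ ℕ), u ∈ L.letters b.1 ∧ c.1 = u :: b.1 := by
  obtain ⟨l, hl, hlen⟩ := c
  match l, hl, hlen with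
  | u :: b, hl, hlen => exact ⟨⟨b, hl.1, by simpa using hlen⟩, u, hl.2, rfl⟩

/-- The cell obtained by deleting the last letter. -/
noncomputable def Cell.parent (c : L.Cell (i + 1)) : L.Cell i := c.exists_eq_cons.choose

/-- The last letter of a cell. -/
noncomputable def Cell.letter (c : L.Cell (i + 1)) : Fin n →₀ ℕ :=
  c.exists_eq_cons.choose_spec.choose

theorem Cell.letter_mem (c : L.Cell (i + 1)) : c.letter ∈ L.letters c.parent.1 :=
  c.exists_eq_cons.choose_spec.choose_spec.1

theorem Cell.val_eq (c : L.Cell (i + 1)) : c.1 = c.letter :: c.parent.1 :=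
  c.exists_eq_cons.choose_spec.choose_spec.2

theorem Cell.ext_iff' {c c' : L.Cell (i + 1)} :
    c = c' ↔ c.parent = c'.parent ∧ c.letter = c'.letter := by
  constructor
  · rintro rfl
    exact ⟨rfl, rfl⟩
  · rintro ⟨h1, h2⟩
    refine Subtype.ext ?_
    rw [c.val_eq, c'.val_eq, h1, h2]

/-- Append a letter. -/
def Cell.cons (c : L.Cell i) (u : Fin n →₀ ℕ) (hu : u ∈ L.letters c.1) : L.Cell (i + 1) :=
  ⟨u :: c.1, ⟨c.2.1, hu⟩, by rw [List.length_cons, c.2.2]⟩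

theorem Cell.cons_spec (c : L.Cell i) (u : Fin n →₀ ℕ) (hu : u ∈ L.letters c.1) :
    (c.cons u hu).letter = u ∧ (c.cons u hu).parent = c := by
  have h := (c.cons u hu).val_eq
  rw [show (c.cons u hu).1 = u :: c.1 from rfl, List.cons.injEq] at h
  exact ⟨h.1.symm, Subtype.ext h.2.symm⟩

theorem Cell.mem_colon (c : L.Cell (i + 1)) (v : Fin n →₀ ℕ) :
    v ∈ L.colon c.1 ↔ c.letter + v ∈ I ∨
      ∃ u' ∈ L.letters c.parent.1, L.prior c.parent.1 u' c.letter ∧ u' ≤ c.letter + v := by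
  rw [colon, c.val_eq]
  rfl

theorem Cell.letter_mem_colon (c : L.Cell (i + 1)) : c.letter ∈ L.colon c.parent.1 :=
  L.letters_subset _ c.parent.2.1 c.letter_mem

/-- Every irreducible element of the colon ideal of a cell is uniquely a letter times an element
outside of the colon ideal of the extended cell. This is the existence. -/
theorem Cell.exists_factor (c : L.Cell i) {w : Fin n →₀ ℕ} (hw : w ∈ L.colon c.1) (hI : w ∉ I) :
    ∃ (c' : L.Cell (i + 1)) (v : Fin n →₀ ℕ), c'.parent = c ∧ c'.letter + v = w ∧
      v ∉ L.colon c'.1 := by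
  obtain ⟨u₀, hu₀, hle₀⟩ := L.exists_letter_le c.1 c.2.1 w hw hI
  let s : Set (Fin n →₀ ℕ) := {u | u ∈ L.letters c.1 ∧ u ≤ w}
  have hs : s.Finite := (Set.finite_Iic w).subset fun u hu => hu.2
  -- Here a minimal element for `prior` is a letter of highest priority; it exists because `w` has
  -- only finitely many divisors.
  have : IsStrictOrder _ (L.prior c.1) :=
    { irrefl := L.prior_irrefl c.1, trans := fun _ _ _ => L.prior_trans }
  have hwf := hs.wellFoundedOn (r := L.prior c.1)
  obtain ⟨⟨u, hu⟩, -, hmin⟩ := hwf.has_min Set.univ ⟨⟨u₀, hu₀, hle₀⟩, trivial⟩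
  obtain ⟨v, hv⟩ := exists_add_of_le hu.2
  obtain ⟨h1, h2⟩ := c.cons_spec u hu.1
  refine ⟨c.cons u hu.1, v, h2, by rw [h1, hv], fun h => ?_⟩
  rw [Cell.mem_colon, h1, h2, ← hv] at h
  rcases h with h | ⟨u', hu', hp, hle⟩
  · exact hI h
  · exact hmin ⟨u', hu', hle⟩ trivial hp

/-- If the letters differed, the one with priority would divide the other product, putting the other
cofactor into its colon set. -/
theorem Cell.factor_unique {c c' : L.Cell (i + 1)} {v v' : Fin n →₀ ℕ}
    (hp : c.parent = c'.parent) (he : c.letter + v = c'.letter + v') (hv : v ∉ L.colon c.1)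
    (hv' : v' ∉ L.colon c'.1) : c = c' ∧ v = v' := by
  have h : c.letter = c'.letter := by
    rcases L.prior_total c.parent.1 c.letter c'.letter with h | h | h
    · exfalso
      rw [Cell.mem_colon, ← he, ← hp] at hv'
      exact hv' (Or.inr ⟨c.letter, c.letter_mem, h, le_self_add⟩)
    · exact h
    · exfalso
      rw [Cell.mem_colon, he] at hv
      exact hv (Or.inr ⟨c'.letter, hp ▸ c'.letter_mem, h, le_self_add⟩)
  refine ⟨Cell.ext_iff'.2 ⟨hp, h⟩, ?_⟩
  rw [h] at he
  exact add_left_cancel he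

variable (L)

/-- The lexicographic order on cells given by the priorities of the letters. -/
def cellLT : List (Fin n →₀ ℕ) → List (Fin n →₀ ℕ) → Prop
  | u :: c, u' :: c' => cellLT c c' ∨ c = c' ∧ L.prior c u u'
  | _, _ => False

variable {L}

theorem cellLT_trans : ∀ {x y z : List (Fin n →₀ ℕ)},
    L.cellLT x y → L.cellLT y z → L.cellLT x z
  | u :: x, v :: y, w :: z, h1, h2 => by
    rcases h1 with h1 | ⟨rfl, h1⟩ <;> rcases h2 with h2 | ⟨rfl, h2⟩
    · exact Or.inl (cellLT_trans h1 h2)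
    · exact Or.inl h1
    · exact Or.inl h2
    · exact Or.inr ⟨rfl, L.prior_trans h1 h2⟩

theorem cellLT_irrefl : ∀ x : List (Fin n →₀ ℕ), ¬ L.cellLT x x
  | [], h => h
  | u :: x, h => by
    rcases h with h | ⟨-, h⟩
    · exact cellLT_irrefl x h
    · exact L.prior_irrefl _ _ h

variable (L) in
/-- A monomial in the free module with basis the cells of length `i`. -/
abbrev Pair (i : ℕ) : Type := L.Cell i × (Fin n →₀ ℕ)

/-- The total degree of a monomial in the free module. -/
noncomputable def Pair.total (p : L.Pair i) : Fin n →₀ ℕ := p.1.1.sum + p.2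

/-- The leading monomial of the image of a monomial under the differential. -/
noncomputable def Pair.lead (p : L.Pair (i + 1)) : L.Pair i := (p.1.parent, p.1.letter + p.2)

theorem Pair.total_lead (p : L.Pair (i + 1)) : p.lead.total = p.total := by
  rw [Pair.total, Pair.total, Pair.lead, p.1.val_eq, List.sum_cons, add_assoc, add_left_comm]

variable {Γ : Type w} [AddCommMonoid Γ] (d : Fin n → Γ)

/-- The (partial) order on the monomials of the free module. Only monomials of the same weight are
comparable. -/
def Pair.Below (p q : L.Pair i) : Prop :=
  Finsupp.weight d p.total = Finsupp.weight d q.total ∧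
    (p.total ≺[MonomialOrder.degLex] q.total ∨ p.total = q.total ∧ L.cellLT p.1.1 q.1.1)

variable {d}

theorem Pair.Below.trans {p q r : L.Pair i} (h1 : p.Below d q) (h2 : q.Below d r) :
    p.Below d r := by
  refine ⟨h1.1.trans h2.1, ?_⟩
  rcases h1.2 with h1 | ⟨e1, h1⟩ <;> rcases h2.2 with h2 | ⟨e2, h2⟩
  · exact Or.inl (h1.trans h2)
  · exact Or.inl (e2 ▸ h1)
  · exact Or.inl (e1 ▸ h2)
  · exact Or.inr ⟨e1.trans e2, cellLT_trans h1 h2⟩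

theorem Pair.Below.irrefl (p : L.Pair i) : ¬ p.Below d p := by
  rintro ⟨-, h | ⟨-, h⟩⟩
  · exact lt_irrefl _ h
  · exact cellLT_irrefl _ h

theorem Pair.Below.add {p q : L.Pair i} (h : p.Below d q) (v : Fin n →₀ ℕ) :
    Pair.Below d (p.1, p.2 + v) (q.1, q.2 + v) := by
  have e : ∀ r : L.Pair i, Pair.total (r.1, r.2 + v) = r.total + v := fun r => by
    simp only [Pair.total, add_assoc]
  rw [Pair.Below, e, e, map_add, map_add, map_add, map_add]
  refine ⟨by rw [h.1], ?_⟩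
  rcases h.2 with h | ⟨h, h'⟩
  · exact Or.inl (by gcongr)
  · exact Or.inr ⟨by rw [h], h'⟩

/-- Totals are unchanged by `lead`, and `cellLT` compares parents before last letters, so the order
refines the one induced by leading terms, as in Schreyer's construction. -/
theorem Pair.below_of_lead {p q : L.Pair (i + 1)} (h : p.lead.Below d q.lead) : p.Below d q := by
  obtain ⟨h1, h2⟩ := h
  rw [Pair.total_lead, Pair.total_lead] at h1 h2
  refine ⟨h1, h2.imp_right fun h => ⟨h.1, ?_⟩⟩
  rw [p.1.val_eq, q.1.val_eq]
  exact Or.inl h.2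

theorem Pair.below_of_lt {c : L.Cell i} {v w : Fin n →₀ ℕ} (h : v ≺[MonomialOrder.degLex] w)
    (h' : Finsupp.weight d v = Finsupp.weight d w) : Pair.Below d (c, v) (c, w) := by
  refine ⟨?_, Or.inl ?_⟩
  · simp only [Pair.total, map_add, h']
  · simp only [Pair.total, map_add]
    gcongr

variable (d) in
-- Degree-lex on totals is a well-order; for equal totals, the comparison of cells is well-founded
-- because there are finitely many of them.
theorem Pair.wellFounded_below [Finite (L.Cell i)] :
    WellFounded (Pair.Below d : L.Pair i → L.Pair i → Prop) := by
  have h1 : WellFounded fun c c' : L.Cell i => L.cellLT c.1 c'.1 := by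
    have : IsTrans (L.Cell i) fun c c' => L.cellLT c.1 c'.1 := ⟨fun _ _ _ => cellLT_trans⟩
    have : Std.Irrefl fun c c' : L.Cell i => L.cellLT c.1 c'.1 := ⟨fun _ => cellLT_irrefl _⟩
    exact Finite.wellFounded_of_trans_of_irrefl _
  have h2 := WellFounded.prod_lex (wellFounded_lt (α := (MonomialOrder.degLex (σ := Fin n)).syn)) h1
  refine Subrelation.wf ?_ (InvImage.wf (fun p : L.Pair i =>
    (MonomialOrder.degLex.toSyn p.total, p.1)) h2)
  rintro p q ⟨-, h | ⟨e, h⟩⟩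
  · exact Prod.Lex.left _ _ h
  · refine Prod.lex_def.2 (Or.inr ⟨?_, h⟩)
    simp only [e]

end LetterSystem

end Cells


/-! ### The resolution attached to a letter system -/

theorem one_tmul_single_of_mk_eq {k : Type u} [Field k] {A : Type u} [CommRing A] [Algebra k A]
    {𝔪 : Ideal A} {ι : Type v} (b : ι) {r : A} {t : k}
    (h : Ideal.Quotient.mk 𝔪 r = t • (1 : A ⧸ 𝔪)) :
    (1 : A ⧸ 𝔪) ⊗ₜ[A] Finsupp.single b r =
      t • ((1 : A ⧸ 𝔪) ⊗ₜ[A] Finsupp.single b (1 : A)) := by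
  have h1 : Finsupp.single b r = r • Finsupp.single b (1 : A) := by
    rw [Finsupp.smul_single, smul_eq_mul, mul_one]
  have h2 : r • (1 : A ⧸ 𝔪) = t • 1 := by
    rw [← h, Algebra.smul_def, mul_one]
    rfl
  rw [h1, TensorProduct.tmul_smul, TensorProduct.smul_tmul', h2, ← TensorProduct.smul_tmul']

namespace LetterSystem

section Resolution

variable {k : Type u} [Field k] {n : ℕ} {Γ : Type w} [AddCommMonoid Γ]
  {a : Ideal (MvPolynomial (Fin n) k)} {d : Fin n → Γ}
  {L : LetterSystem (initialMonomials a)} {i : ℕ}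

/-- A monomial as an element of the free module. -/
noncomputable def Pair.elem (p : L.Pair i) : L.Cell i →₀ (MvPolynomial (Fin n) k ⧸ a) :=
  Finsupp.single p.1 (residueMonomial a p.2)

theorem Pair.smul_elem (p : L.Pair i) (v : Fin n →₀ ℕ) :
    residueMonomial a v • p.elem = Pair.elem (p.1, p.2 + v) := by
  rw [elem, elem, Finsupp.smul_single, smul_eq_mul, mul_comm, residueMonomial_add]

/-- The span of the monomials satisfying a predicate. -/
noncomputable def monomialSpan (T : L.Pair i → Prop) :
    Submodule k (L.Cell i →₀ (MvPolynomial (Fin n) k ⧸ a)) :=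
  Submodule.span k (Pair.elem '' {p | T p})

theorem elem_mem_monomialSpan {T : L.Pair i → Prop} {p : L.Pair i} (h : T p) :
    p.elem ∈ monomialSpan T :=
  Submodule.subset_span ⟨p, h, rfl⟩

theorem monomialSpan_le {T : L.Pair i → Prop}
    {N : Submodule k (L.Cell i →₀ (MvPolynomial (Fin n) k ⧸ a))} (h : ∀ p, T p → p.elem ∈ N) :
    monomialSpan T ≤ N := by
  refine Submodule.span_le.2 ?_
  rintro _ ⟨p, hp, rfl⟩
  exact h p hp

theorem monomialSpan_mono {T T' : L.Pair i → Prop} (h : ∀ p, T p → T' p) :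
    monomialSpan T ≤ monomialSpan T' :=
  monomialSpan_le fun p hp => elem_mem_monomialSpan (h p hp)

theorem monomialSpan_true : monomialSpan (fun _ : L.Pair i => True) = ⊤ := by
  refine eq_top_iff.2 fun x _ => ?_
  induction x using Finsupp.induction_linear with
  | zero => exact Submodule.zero_mem _
  | add x y hx hy => exact Submodule.add_mem _ (hx trivial) (hy trivial)
  | single c r =>
    have hr : r ∈ Submodule.span k (Set.range (residueMonomial a)) := by
      rw [span_range_residueMonomial]; trivial
    clear * - hr
    induction hr using Submodule.span_induction with
    | mem x hx =>
      obtain ⟨v, rfl⟩ := hx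
      exact elem_mem_monomialSpan (p := (c, v)) trivial
    | zero => rw [Finsupp.single_zero]; exact Submodule.zero_mem _
    | add x y _ _ hx hy => rw [Finsupp.single_add]; exact Submodule.add_mem _ hx hy
    | smul t x _ hx => rw [← Finsupp.smul_single]; exact Submodule.smul_mem _ _ hx

theorem smul_mem_monomialSpan {T T' : L.Pair i → Prop} (v : Fin n →₀ ℕ)
    (h : ∀ p, T p → T' (p.1, p.2 + v)) {x : L.Cell i →₀ (MvPolynomial (Fin n) k ⧸ a)}
    (hx : x ∈ monomialSpan T) : residueMonomial a v • x ∈ monomialSpan T' := by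
  have hle : monomialSpan T ≤ (monomialSpan T').comap
      (Module.toModuleEnd k (S := MvPolynomial (Fin n) k ⧸ a)
        (L.Cell i →₀ (MvPolynomial (Fin n) k ⧸ a)) (residueMonomial a v)) := by
    refine monomialSpan_le fun p hp => ?_
    change residueMonomial a v • p.elem ∈ monomialSpan T'
    rw [Pair.smul_elem]
    exact elem_mem_monomialSpan (h p hp)
  exact hle hx

variable (d) in
/-- The span of the monomials below a given one. -/
noncomputable abbrev low (p : L.Pair i) : Submodule k (L.Cell i →₀ (MvPolynomial (Fin n) k ⧸ a)) :=
  monomialSpan fun q => q.Below d p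

theorem elem_mem_low_of_reducible (hd : IsHomogeneousFor d a) {p : L.Pair i}
    (hp : p.2 ∈ initialMonomials a) : p.elem ∈ low d p := by
  have h := Submodule.mem_map_of_mem
    (f := Finsupp.lsingle (R := k) (M := MvPolynomial (Fin n) k ⧸ a) p.1)
    (residueMonomial_mem_span_lt hd hp)
  rw [Submodule.map_span] at h
  refine Submodule.span_le.2 ?_ h
  rintro _ ⟨_, ⟨v, ⟨hv, hv'⟩, rfl⟩, rfl⟩
  exact elem_mem_monomialSpan (p := (p.1, v)) (Pair.below_of_lt hv hv')

variable (d) in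
/-- A map between the free modules on the cells with the prescribed leading terms. -/
def IsLeading (D : (L.Cell (i + 1) →₀ (MvPolynomial (Fin n) k ⧸ a)) →ₗ[MvPolynomial (Fin n) k ⧸ a]
    (L.Cell i →₀ (MvPolynomial (Fin n) k ⧸ a))) : Prop :=
  ∀ c : L.Cell (i + 1),
    D (Finsupp.single c 1) - (Pair.lead (c, 0)).elem ∈ low d (Pair.lead (c, 0))

section Leading

variable {D : (L.Cell (i + 1) →₀ (MvPolynomial (Fin n) k ⧸ a)) →ₗ[MvPolynomial (Fin n) k ⧸ a]
    (L.Cell i →₀ (MvPolynomial (Fin n) k ⧸ a))}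

/-- Multiplication by a monomial preserves `Below`. The leading monomial may become reducible, in
which case the whole image lies in `low`. -/
theorem IsLeading.map_elem (hD : IsLeading d D) (p : L.Pair (i + 1)) :
    D p.elem - p.lead.elem ∈ low d p.lead := by
  obtain ⟨c, v⟩ := p
  have h1 : (Pair.elem (c, v) : L.Cell (i + 1) →₀ (MvPolynomial (Fin n) k ⧸ a)) =
      residueMonomial a v • Finsupp.single c 1 := by
    rw [Pair.elem, Finsupp.smul_single, smul_eq_mul, mul_one]
  have h2 : (Pair.lead (c, v)).elem = residueMonomial a v • (Pair.lead (c, 0)).elem := by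
    rw [Pair.smul_elem]
    simp [Pair.lead]
  rw [h1, h2, map_smul, ← smul_sub]
  refine smul_mem_monomialSpan v (fun p hp => ?_) (hD c)
  have := hp.add v
  simpa [Pair.lead] using this

variable [Finite (L.Cell i)]

/-- Elimination by induction along `Below`: a reducible monomial is rewritten by lower ones, one in
the colon set is a leading term of `D` and is replaced by an image plus lower terms, and the rest
stay. The down-closed `T` records that nothing larger appears. -/
theorem monomialSpan_le_sup (hd : IsHomogeneousFor d a) (hD : IsLeading d D) {T : L.Pair i → Prop}
    (hT : ∀ p q, T q → p.Below d q → T p) :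
    monomialSpan T ≤ (monomialSpan fun p : L.Pair (i + 1) => T p.lead).map
      (D.restrictScalars k) ⊔ monomialSpan fun p : L.Pair i => p.2 ∉ L.colon p.1.1 := by
  refine monomialSpan_le fun p hp => ?_
  induction p using (Pair.wellFounded_below (L := L) (i := i) d).induction with
  | _ p ih =>
  have hlow : low d p ≤ (monomialSpan fun p : L.Pair (i + 1) => T p.lead).map
      (D.restrictScalars k) ⊔ monomialSpan fun p : L.Pair i => p.2 ∉ L.colon p.1.1 :=
    monomialSpan_le fun q hq => ih q hq (hT q p hp hq)
  by_cases hI : p.2 ∈ initialMonomials a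
  · exact hlow (elem_mem_low_of_reducible hd hI)
  by_cases hc : p.2 ∈ L.colon p.1.1
  · obtain ⟨c, v, h1, h2, -⟩ := p.1.exists_factor hc hI
    have hl : Pair.lead (c, v) = p := Prod.ext h1 h2
    have h3 := hD.map_elem (c, v)
    rw [hl] at h3
    replace h3 := hlow h3
    have h4 := Submodule.sub_mem _ (Submodule.mem_sup_left (Submodule.mem_map_of_mem
      (f := D.restrictScalars k) (elem_mem_monomialSpan (T := fun p => T p.lead)
        (p := (c, v)) (hl.symm ▸ hp)))) h3
    rwa [LinearMap.restrictScalars_apply, sub_sub_cancel] at h4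
  · exact Submodule.mem_sup_right (elem_mem_monomialSpan hc)

/-- The map `f` stands for the previous differential or the augmentation. After elimination, the
remainder outside the colon sets lies in the kernel of `f` and so vanishes. With `T` trivial this is
exactness; with a proper `T` it bounds the preimage. -/
theorem exists_preimage {Q : Type*} [AddCommGroup Q] [Module k Q]
    (hd : IsHomogeneousFor d a) (hD : IsLeading d D)
    (f : (L.Cell i →₀ (MvPolynomial (Fin n) k ⧸ a)) →ₗ[k] Q)
    (hf : ∀ x ∈ monomialSpan (fun p : L.Pair i => p.2 ∉ L.colon p.1.1), f x = 0 → x = 0)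
    (hfD : ∀ x, f (D x) = 0) {T : L.Pair i → Prop} (hT : ∀ p q, T q → p.Below d q → T p)
    {y : L.Cell i →₀ (MvPolynomial (Fin n) k ⧸ a)} (hy : y ∈ monomialSpan T) (hy₀ : f y = 0) :
    ∃ x ∈ monomialSpan (fun p : L.Pair (i + 1) => T p.lead), D x = y := by
  obtain ⟨_, ⟨x, hx, rfl⟩, z, hz, rfl⟩ := Submodule.mem_sup.1 (monomialSpan_le_sup hd hD hT hy)
  rw [LinearMap.restrictScalars_apply, map_add, hfD, zero_add] at hy₀
  refine ⟨x, hx, ?_⟩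
  rw [hf z hz hy₀, add_zero, LinearMap.restrictScalars_apply]

end Leading

/-- The coefficient of an irreducible monomial. -/
noncomputable def coeffPair (p : L.Pair i) (hp : p.2 ∉ initialMonomials a) :
    (L.Cell i →₀ (MvPolynomial (Fin n) k ⧸ a)) →ₗ[k] k :=
  ((irreducibleBasis a).coord ⟨p.2, hp⟩).comp (Finsupp.lapply p.1)

theorem coeffPair_self (p : L.Pair i) (hp : p.2 ∉ initialMonomials a) :
    coeffPair p hp p.elem = 1 := by
  rw [coeffPair, LinearMap.comp_apply, Pair.elem, Finsupp.lapply_apply, Finsupp.single_eq_same]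
  exact coord_residueMonomial_self ⟨p.2, hp⟩

theorem eq_or_below_of_coeffPair_ne_zero (hd : IsHomogeneousFor d a) (p : L.Pair i)
    (hp : p.2 ∉ initialMonomials a) (q : L.Pair i) (h : coeffPair p hp q.elem ≠ 0) :
    p = q ∨ p.Below d q := by
  rw [coeffPair, LinearMap.comp_apply, Pair.elem, Finsupp.lapply_apply] at h
  obtain ⟨c, v⟩ := p
  obtain ⟨c', v'⟩ := q
  by_cases hc : c = c'
  · subst hc
    rw [Finsupp.single_eq_same] at h
    rcases eq_or_lt_of_coord_ne_zero hd ⟨v, hp⟩ v' h with h | ⟨h, h'⟩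
    · exact Or.inl (Prod.ext rfl h)
    · exact Or.inr (Pair.below_of_lt h h')
  · rw [Finsupp.single_eq_of_ne hc, map_zero] at h
    exact absurd rfl h

theorem coeffPair_eq_zero_of_mem_low (hd : IsHomogeneousFor d a) (p : L.Pair i)
    (hp : p.2 ∉ initialMonomials a) (q : L.Pair i) (hpq : ¬ p.Below d q)
    {x : L.Cell i →₀ (MvPolynomial (Fin n) k ⧸ a)} (hx : x ∈ low d q) : coeffPair p hp x = 0 := by
  have hle : low d q ≤ LinearMap.ker (coeffPair p hp) := by
    refine monomialSpan_le fun r hr => LinearMap.mem_ker.2 ?_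
    by_contra h
    rcases eq_or_below_of_coeffPair_ne_zero hd p hp r h with rfl | h
    · exact hpq hr
    · exact hpq (h.trans hr)
  exact hle hx

/-- By unique factorization distinct monomials outside the colon sets have distinct irreducible
leading terms, so a maximal one cannot cancel. -/
theorem IsLeading.injOn (hd : IsHomogeneousFor d a)
    {D : (L.Cell (i + 1) →₀ (MvPolynomial (Fin n) k ⧸ a)) →ₗ[MvPolynomial (Fin n) k ⧸ a]
      (L.Cell i →₀ (MvPolynomial (Fin n) k ⧸ a))} (hD : IsLeading d D)
    {x : L.Cell (i + 1) →₀ (MvPolynomial (Fin n) k ⧸ a)}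
    (hx : x ∈ monomialSpan (fun p : L.Pair (i + 1) => p.2 ∉ L.colon p.1.1)) (h0 : D x = 0) :
    x = 0 := by
  classical
  rw [monomialSpan, Finsupp.mem_span_image_iff_linearCombination] at hx
  obtain ⟨l, hl, rfl⟩ := hx
  by_contra hne
  have hl0 : l.support.Nonempty := by
    rw [Finsupp.support_nonempty_iff]
    rintro rfl
    exact hne (map_zero _)
  -- The order is reversed, so that a minimal element of the support has maximal leading monomial.
  have : IsStrictOrder (L.Pair (i + 1)) fun p q => q.lead.Below d p.lead :=
    { irrefl := fun p => Pair.Below.irrefl _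
      trans := fun _ _ _ h1 h2 => h2.trans h1 }
  have hwf := l.support.finite_toSet.wellFoundedOn
    (r := fun p q : L.Pair (i + 1) => q.lead.Below d p.lead)
  obtain ⟨q₀, hq₀⟩ := hl0
  obtain ⟨⟨q, hq⟩, -, hmax⟩ := hwf.has_min Set.univ ⟨⟨q₀, hq₀⟩, trivial⟩
  have hU : ∀ p ∈ l.support, p.2 ∉ L.colon p.1.1 := fun p hp => hl hp
  have hqI : q.lead.2 ∉ initialMonomials a := fun h =>
    hU q hq ((Cell.mem_colon _ _).2 (Or.inl h))
  have h1 : ∀ p ∈ l.support, p ≠ q → coeffPair q.lead hqI (D p.elem) = 0 := by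
    intro p hp hpq
    have hnb : ¬ q.lead.Below d p.lead := hmax ⟨p, hp⟩ trivial
    have h2 := coeffPair_eq_zero_of_mem_low hd _ hqI _ hnb (hD.map_elem p)
    have h3 : coeffPair q.lead hqI p.lead.elem = 0 := by
      by_contra h
      rcases eq_or_below_of_coeffPair_ne_zero hd _ hqI _ h with h | h
      · obtain ⟨e1, e2⟩ := Prod.mk.injEq .. ▸ h
        obtain ⟨e3, e4⟩ := Cell.factor_unique e1 e2 (hU q hq) (hU p hp)
        exact hpq (Prod.ext e3 e4).symm
      · exact hnb h
    rwa [map_sub, h3, sub_zero] at h2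
  have h2 : coeffPair q.lead hqI (D q.elem) = 1 := by
    have := coeffPair_eq_zero_of_mem_low hd _ hqI _ (Pair.Below.irrefl _) (hD.map_elem q)
    rwa [map_sub, coeffPair_self, sub_eq_zero] at this
  have h3 := congrArg (coeffPair q.lead hqI) h0
  rw [Finsupp.linearCombination_apply, Finsupp.sum, map_sum, map_sum, map_zero,
    Finset.sum_eq_single q] at h3
  · rw [LinearMap.map_smul_of_tower, map_smul, h2, smul_eq_mul, mul_one] at h3
    exact Finsupp.mem_support_iff.1 hq h3
  · intro p hp hpq
    rw [LinearMap.map_smul_of_tower, map_smul, h1 p hp hpq, smul_zero]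
  · intro h
    exact absurd hq h

/-- The inductive step in the construction of the resolution. -/
theorem exists_next (hd : IsHomogeneousFor d a)
    {D : (L.Cell (i + 1) →₀ (MvPolynomial (Fin n) k ⧸ a)) →ₗ[MvPolynomial (Fin n) k ⧸ a]
      (L.Cell i →₀ (MvPolynomial (Fin n) k ⧸ a))} (hD : IsLeading d D)
    (hB : ∀ p : L.Pair i, ∀ x, D x ∈ low d p →
      ∃ y ∈ monomialSpan (fun q : L.Pair (i + 1) => q.lead.Below d p), D y = D x) :
    ∃ D' : (L.Cell (i + 2) →₀ (MvPolynomial (Fin n) k ⧸ a)) →ₗ[MvPolynomial (Fin n) k ⧸ a]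
      (L.Cell (i + 1) →₀ (MvPolynomial (Fin n) k ⧸ a)),
      IsLeading d D' ∧ ∀ x, D (D' x) = 0 := by
  have key : ∀ c : L.Cell (i + 2), ∃ y, y - (Pair.lead (c, 0)).elem ∈ low d (Pair.lead (c, 0)) ∧
      D y = 0 := by
    intro c
    set p : L.Pair (i + 1) := Pair.lead (c, 0) with hp
    -- An approximate cycle is enough: by `hB` its image under `D` also has a preimage with smaller
    -- leading terms, and subtracting that gives a true cycle with the same leading term.
    suffices h : ∃ y, y - p.elem ∈ low d p ∧ D y ∈ low d p.lead by
      obtain ⟨y, hy, hDy⟩ := h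
      obtain ⟨z, hz, hDz⟩ := hB p.lead y hDy
      refine ⟨y - z, ?_, by rw [map_sub, hDz, sub_self]⟩
      rw [sub_right_comm]
      exact Submodule.sub_mem _ hy (monomialSpan_mono (fun q hq => Pair.below_of_lead hq) hz)
    have hmem : p.2 ∈ L.colon p.1.1 := by
      have := c.letter_mem_colon
      simpa [hp, Pair.lead] using this
    -- Either the leading term of `D p.elem` is reducible, or another monomial of higher priority
    -- has the same leading term and the two cancel.
    rcases (Cell.mem_colon _ _).1 hmem with h | ⟨u, hu, hprior, hle⟩
    · refine ⟨p.elem, by rw [sub_self]; exact Submodule.zero_mem _, ?_⟩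
      have h1 := elem_mem_low_of_reducible (p := p.lead) hd h
      have h2 := Submodule.add_mem _ (hD.map_elem p) h1
      rwa [sub_add_cancel] at h2
    · obtain ⟨v, hv⟩ := exists_add_of_le hle
      obtain ⟨e1, e2⟩ := p.1.parent.cons_spec u hu
      set q : L.Pair (i + 1) := (p.1.parent.cons u hu, v) with hq
      have hlead : q.lead = p.lead := by
        refine Prod.ext e2 ?_
        change (p.1.parent.cons u hu).letter + v = p.1.letter + p.2
        rw [e1, hv]
      have htot : q.total = p.total := by rw [← Pair.total_lead, hlead, Pair.total_lead]
      have hbelow : q.Below d p := by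
        refine ⟨by rw [htot], Or.inr ⟨htot, ?_⟩⟩
        rw [p.1.val_eq]
        exact Or.inr ⟨rfl, hprior⟩
      refine ⟨p.elem - q.elem, ?_, ?_⟩
      · rw [sub_sub_cancel_left]
        exact Submodule.neg_mem _ (elem_mem_monomialSpan hbelow)
      · have h1 := hD.map_elem q
        rw [hlead] at h1
        have h2 := Submodule.sub_mem _ (hD.map_elem p) h1
        rwa [sub_sub_sub_cancel_right, ← map_sub] at h2
  choose y hy hDy using key
  refine ⟨Finsupp.linearCombination (MvPolynomial (Fin n) k ⧸ a) y, fun c => ?_, fun x => ?_⟩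
  · rw [Finsupp.linearCombination_single, one_smul]
    exact hy c
  · rw [Finsupp.linearCombination_apply, Finsupp.sum, map_sum]
    refine Finset.sum_eq_zero fun c _ => ?_
    rw [map_smul, hDy, smul_zero]

/-! ### Augmentation and assembly of the resolution. -/

variable [∀ i, Finite (L.Cell i)]

/-- The first differential of the resolution. -/
noncomputable def firstDiff (L : LetterSystem (initialMonomials a)) :
    (L.Cell 1 →₀ (MvPolynomial (Fin n) k ⧸ a)) →ₗ[MvPolynomial (Fin n) k ⧸ a]
      (L.Cell 0 →₀ (MvPolynomial (Fin n) k ⧸ a)) :=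
  Finsupp.linearCombination _ fun c => (Pair.lead (c, 0)).elem

omit [∀ i, Finite (L.Cell i)] in
theorem isLeading_firstDiff : IsLeading d (firstDiff L) := fun c => by
  rw [firstDiff, Finsupp.linearCombination_single, one_smul, sub_self]
  exact Submodule.zero_mem _

/-- The augmentation of the resolution. -/
noncomputable def augmentation (L : LetterSystem (initialMonomials a)) :
    (L.Cell 0 →₀ (MvPolynomial (Fin n) k ⧸ a)) →ₗ[MvPolynomial (Fin n) k ⧸ a]
      (MvPolynomial (Fin n) k ⧸ a) ⧸ augIdeal a :=
  Finsupp.linearCombination _ fun _ => 1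

omit [∀ i, Finite (L.Cell i)] in
theorem augmentation_single (c : L.Cell 0) (r : MvPolynomial (Fin n) k ⧸ a) :
    augmentation L (Finsupp.single c r) = Ideal.Quotient.mk (augIdeal a) r := by
  rw [augmentation, Finsupp.linearCombination_single, ← map_one (Ideal.Quotient.mk (augIdeal a))]
  change Ideal.Quotient.mk (augIdeal a) (r * 1) = _
  rw [mul_one]

theorem residueMonomial_mem_augIdeal {w : Fin n →₀ ℕ} (hw : w ≠ 0) :
    residueMonomial a w ∈ augIdeal a := by
  obtain ⟨j, hj⟩ := Finsupp.ne_iff.1 hw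
  refine Ideal.mem_map_of_mem _ ?_
  have hle : Finsupp.single j 1 ≤ w := by
    rw [Finsupp.single_le_iff]
    exact Nat.one_le_iff_ne_zero.2 hj
  obtain ⟨v, rfl⟩ := exists_add_of_le hle
  rw [← mul_one (1 : k), ← monomial_mul]
  exact Ideal.mul_mem_right _ _ (Ideal.subset_span ⟨j, rfl⟩)

theorem mk_notMem_augIdeal (ha : a ≤ idealOfVars (Fin n) k) {f : MvPolynomial (Fin n) k}
    (hf : coeff 0 f ≠ 0) : Ideal.Quotient.mk a f ∉ augIdeal a := by
  intro h
  rw [augIdeal, Ideal.mem_map_iff_of_surjective _ Ideal.Quotient.mk_surjective] at h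
  obtain ⟨g, hg, hgf⟩ := h
  have h1 := ha (Ideal.Quotient.eq.1 hgf)
  have h2 := coeff_zero_of_mem_idealOfVars h1
  rw [coeff_sub, coeff_zero_of_mem_idealOfVars hg, zero_sub, neg_eq_zero] at h2
  exact hf h2

omit [∀ i, Finite (L.Cell i)] in
theorem augmentation_firstDiff (x) : augmentation L (firstDiff L x) = 0 := by
  have h : (augmentation L).comp (firstDiff L) = 0 := by
    ext c : 2
    simp only [LinearMap.comp_apply, Finsupp.lsingle_apply, LinearMap.zero_apply, firstDiff,
      Finsupp.linearCombination_single, one_smul]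
    rw [Pair.elem, augmentation_single, Ideal.Quotient.eq_zero_iff_mem]
    refine residueMonomial_mem_augIdeal ?_
    have h1 : c.letter ≠ 0 := by
      have h1 := c.letter_mem_colon
      rw [c.parent.eq_nil] at h1
      exact h1
    simpa [Pair.lead] using h1
  exact LinearMap.congr_fun h x

omit [∀ i, Finite (L.Cell i)] in
-- Outside the colon set of the empty cell there is only the monomial `1`, whose image is nonzero
-- because `a` lies in the ideal of the variables.
theorem augmentation_injOn (ha : a ≤ idealOfVars (Fin n) k)
    {x : L.Cell 0 →₀ (MvPolynomial (Fin n) k ⧸ a)}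
    (hx : x ∈ monomialSpan (fun p : L.Pair 0 => p.2 ∉ L.colon p.1.1))
    (h0 : augmentation L x = 0) : x = 0 := by
  have hle : monomialSpan (fun p : L.Pair 0 => p.2 ∉ L.colon p.1.1) ≤
      Submodule.span k {Finsupp.single L.nil (1 : MvPolynomial (Fin n) k ⧸ a)} := by
    refine monomialSpan_le fun p hp => Submodule.subset_span ?_
    have h1 : p.2 = 0 := by
      by_contra h
      rw [p.1.eq_nil] at hp
      exact hp h
    rw [Pair.elem, h1, residueMonomial_zero, p.1.eq_nil]
    rfl
  obtain ⟨t, rfl⟩ := Submodule.mem_span_singleton.1 (hle hx)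
  rw [LinearMap.map_smul_of_tower, augmentation_single] at h0
  have h1 : t = 0 := by
    by_contra ht
    have h2 : Ideal.Quotient.mk (augIdeal a) 1 = 0 := by
      rw [← inv_smul_smul₀ ht ((Ideal.Quotient.mk (augIdeal a)) 1), h0, smul_zero]
    rw [Ideal.Quotient.eq_zero_iff_mem] at h2
    exact mk_notMem_augIdeal ha (f := 1) (by simp) (by simpa using h2)
  rw [h1, zero_smul]

theorem exists_differentials (ha : a ≤ idealOfVars (Fin n) k) (hd : IsHomogeneousFor d a) :
    ∃ D : ∀ i, (L.Cell (i + 1) →₀ (MvPolynomial (Fin n) k ⧸ a)) →ₗ[MvPolynomial (Fin n) k ⧸ a]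
      (L.Cell i →₀ (MvPolynomial (Fin n) k ⧸ a)),
      (∀ i, IsLeading d (D i)) ∧ Function.Exact (D 0) (augmentation L) ∧
      ∀ i, Function.Exact (D (i + 1)) (D i) := by
  -- The recursion carries, besides the leading terms, the existence of bounded preimages required
  -- by `exists_next`.
  let S : ℕ → Type _ := fun i =>
    {D : (L.Cell (i + 1) →₀ (MvPolynomial (Fin n) k ⧸ a)) →ₗ[MvPolynomial (Fin n) k ⧸ a]
      (L.Cell i →₀ (MvPolynomial (Fin n) k ⧸ a)) // IsLeading d D ∧
      ∀ p : L.Pair i, ∀ x, D x ∈ low d p →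
        ∃ y ∈ monomialSpan (fun q : L.Pair (i + 1) => q.lead.Below d p), D y = D x}
  have hbelow : ∀ (i : ℕ) (r p q : L.Pair i), q.Below d r → p.Below d q → p.Below d r :=
    fun i r p q h1 h2 => h2.trans h1
  let D₀ : S 0 := ⟨firstDiff L, isLeading_firstDiff, fun p x hx =>
    exists_preimage hd isLeading_firstDiff ((augmentation L).restrictScalars k)
      (fun x hx h0 => augmentation_injOn ha hx h0) augmentation_firstDiff (hbelow 0 p) hx
      (augmentation_firstDiff x)⟩
  have step : ∀ i (D : S i), ∃ D' : S (i + 1), ∀ x, D.1 (D'.1 x) = 0 := by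
    rintro i ⟨D, hD, hB⟩
    obtain ⟨D', hD', hDD'⟩ := exists_next hd hD hB
    exact ⟨⟨D', hD', fun p x hx => exists_preimage hd hD' (D.restrictScalars k)
      (fun x hx h0 => hD.injOn hd hx h0) hDD' (hbelow (i + 1) p) hx (hDD' x)⟩, hDD'⟩
  choose next hnext using step
  let F : ∀ i, S i := fun i => Nat.rec D₀ next i
  refine ⟨fun i => (F i).1, fun i => (F i).2.1, fun y => ⟨fun hy => ?_, ?_⟩,
    fun i y => ⟨fun hy => ?_, ?_⟩⟩
  · obtain ⟨x, -, hx⟩ := exists_preimage hd (isLeading_firstDiff (L := L) (d := d))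
      ((augmentation L).restrictScalars k)
      (fun x hx h0 => augmentation_injOn ha hx h0) augmentation_firstDiff
      (T := fun _ => True) (fun _ _ _ _ => trivial) (y := y)
      (by rw [monomialSpan_true]; trivial) hy
    exact ⟨x, hx⟩
  · rintro ⟨x, rfl⟩
    exact augmentation_firstDiff x
  · obtain ⟨x, -, hx⟩ := exists_preimage hd (F (i + 1)).2.1 ((F i).1.restrictScalars k)
      (fun x hx h0 => (F i).2.1.injOn hd hx h0) (hnext i (F i))
      (T := fun _ => True) (fun _ _ _ _ => trivial) (y := y)
      (by rw [monomialSpan_true]; trivial) hy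
    exact ⟨x, hx⟩
  · rintro ⟨x, rfl⟩
    exact hnext i (F i) x

omit [∀ i, Finite (L.Cell i)] in
theorem elem_mem_freeComponent (p : L.Pair i) :
    p.elem ∈ freeComponent (algComponent d a)
      (fun c : L.Cell i => Finsupp.weight d c.1.sum) (Finsupp.weight d p.total) := by
  have := single_mem_freeComponent (fun c : L.Cell i => Finsupp.weight d c.1.sum) p.1
    (residueMonomial_mem_algComponent (a := a) d p.2)
  rwa [← map_add, add_comm] at this

omit [∀ i, Finite (L.Cell i)] in
theorem mk_mk_eq_coeff_smul (f : MvPolynomial (Fin n) k) :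
    Ideal.Quotient.mk (augIdeal a) (Ideal.Quotient.mk a f) =
      coeff 0 f • (1 : (MvPolynomial (Fin n) k ⧸ a) ⧸ augIdeal a) := by
  rw [mk_eq_sum, ← Ideal.Quotient.mkₐ_eq_mk k, map_sum, Finset.sum_eq_single 0]
  · rw [map_smul, residueMonomial_zero, map_one]
  · intro v _ hv
    rw [map_smul, Ideal.Quotient.mkₐ_eq_mk,
      Ideal.Quotient.eq_zero_iff_mem.2 (residueMonomial_mem_augIdeal hv), smul_zero]
  · intro h
    rw [notMem_support_iff.1 h, zero_smul, map_zero]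

omit [∀ i, Finite (L.Cell i)] in
-- After tensoring, a coefficient acts through its constant term, and a homogeneous coefficient with
-- nonzero constant term has degree `0`.
theorem tensorComponent_le (P : GradedFreeResolution.{u, v, w} (algComponent d a) (augIdeal a))
    (i : ℕ) (γ : Γ) : P.tensorComponent i γ ≤ Submodule.span k
      (Set.range fun b : {b // P.deg i b = γ} =>
        (1 : (MvPolynomial (Fin n) k ⧸ a) ⧸ augIdeal a) ⊗ₜ[MvPolynomial (Fin n) k ⧸ a]
          Finsupp.single b.1 (1 : MvPolynomial (Fin n) k ⧸ a)) := by
  rw [GradedFreeResolution.tensorComponent, Submodule.map_le_iff_le_comap, freeComponent,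
    Submodule.span_le]
  rintro _ ⟨b, δ, _, ⟨f, hf, rfl⟩, hγ, rfl⟩
  change (1 : (MvPolynomial (Fin n) k ⧸ a) ⧸ augIdeal a) ⊗ₜ[MvPolynomial (Fin n) k ⧸ a]
    Finsupp.single b (Ideal.Quotient.mk a f) ∈ Submodule.span k _
  rw [one_tmul_single_of_mk_eq b (mk_mk_eq_coeff_smul f)]
  by_cases h0 : coeff 0 f = 0
  · rw [h0, zero_smul]
    exact Submodule.zero_mem _
  · have hδ : (0 : Γ) = δ := by
      rw [← hf h0, map_zero]
    rw [← hδ, zero_add] at hγ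
    exact Submodule.smul_mem _ _ (Submodule.subset_span ⟨⟨b, hγ⟩, rfl⟩)

/-- The dimension of `Tor` is bounded by the number of cells. -/
theorem finrank_tor_le_card (ha : a ≤ idealOfVars (Fin n) k) (hd : IsHomogeneousFor d a)
    (L : LetterSystem (initialMonomials a)) [∀ i, Finite (L.Cell i)]
    (R : GradedFreeResolution.{u, v, w} (algComponent d a) (augIdeal a)) (i : ℕ) (γ : Γ) :
    Module.Finite k (R.Tor i γ) ∧ Module.finrank k (R.Tor i γ) ≤
      Nat.card {c : L.Cell i // Finsupp.weight d c.1.sum = γ} := by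
  obtain ⟨D, hD, h0, h1⟩ := exists_differentials (L := L) ha hd
  let deg : ∀ i, L.Cell i → Γ := fun i c => Finsupp.weight d c.1.sum
  let P : GradedFreeResolution.{u, 0, w} (algComponent d a) (augIdeal a) :=
    { basis := L.Cell
      deg := deg
      diff := D
      aug := augmentation L
      diff_homogeneous := fun i => by
        refine (algGrading hd).map_mem_freeComponent _ _ (D i) fun c => ?_
        have hγ : Finsupp.weight d (Pair.lead (c, 0)).total = deg (i + 1) c := by
          rw [Pair.total_lead, Pair.total, add_zero]
        -- Equality of weights is part of `Below`, so the correction terms have the right degree.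
        have h2 : low d (Pair.lead (c, 0)) ≤
            freeComponent (algComponent d a) (deg i) (deg (i + 1) c) := by
          refine monomialSpan_le fun p hp => ?_
          rw [← hγ, ← hp.1]
          exact elem_mem_freeComponent p
        have h3 := Submodule.add_mem _ (h2 (hD i c)) (hγ ▸ elem_mem_freeComponent _)
        rwa [sub_add_cancel] at h3
      aug_homogeneous := by
        intro γ hγ x hx
        induction hx using Submodule.span_induction with
        | mem x hx =>
          obtain ⟨c, δ, _, ⟨f, hf, rfl⟩, hδ, rfl⟩ := hx
          rw [augmentation_single]
          change Ideal.Quotient.mk _ (Ideal.Quotient.mk a f) = 0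
          rw [mk_mk_eq_coeff_smul]
          have : coeff 0 f = 0 := by
            by_contra h
            have h4 := hf h
            rw [map_zero] at h4
            refine hγ ?_
            rw [← hδ, ← h4, zero_add, c.eq_nil]
            exact map_zero _
          rw [this, zero_smul]
        | zero => exact map_zero _
        | add x y _ _ hx hy => rw [map_add, hx, hy, add_zero]
        | smul t x _ hx => rw [LinearMap.map_smul_of_tower, hx, smul_zero]
      aug_surjective := fun y => by
        obtain ⟨r, rfl⟩ := Ideal.Quotient.mk_surjective y
        exact ⟨Finsupp.single L.nil r, augmentation_single _ _⟩
      exact_zero := h0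
      exact_succ := h1 }
  have hfin : Finite {b // P.deg i b = γ} :=
    inferInstanceAs (Finite {c : L.Cell i // deg i c = γ})
  have : Fintype {b // P.deg i b = γ} := Fintype.ofFinite _
  have hle := tensorComponent_le P i γ
  have hfd := FiniteDimensional.span_of_finite k (Set.finite_range fun b : {b // P.deg i b = γ} =>
        (1 : (MvPolynomial (Fin n) k ⧸ a) ⧸ augIdeal a) ⊗ₜ[MvPolynomial (Fin n) k ⧸ a]
          Finsupp.single b.1 (1 : MvPolynomial (Fin n) k ⧸ a))
  have hfd' : Module.Finite k (P.tensorComponent i γ) := Submodule.finiteDimensional_of_le hle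
  obtain ⟨h2, h3⟩ := GradedFreeResolution.finrank_tor_le (algGrading hd) R P i γ
  refine ⟨h2, h3.trans ((Submodule.finrank_mono hle).trans ((finrank_range_le_card _).trans ?_))⟩
  rw [← Nat.card_eq_fintype_card]

end Resolution

end LetterSystem


/-! ### The letter system of minimal fully attached tuples -/

section AttachedTuples

variable {k : Type u} [Field k] {n : ℕ} {a : Ideal (MvPolynomial (Fin n) k)}

theorem single_le_iff_mem_support {j : Fin n} {w : Fin n →₀ ℕ} :
    Finsupp.single j 1 ≤ w ↔ j ∈ w.support := by
  rw [Finsupp.single_le_iff, Finsupp.mem_support_iff, Nat.one_le_iff_ne_zero]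

theorem mem_support_of_single_le_add {j : Fin n} {v w : Fin n →₀ ℕ}
    (h : Finsupp.single j 1 ≤ v + w) : j ∈ v.support ∨ j ∈ w.support := by
  rw [single_le_iff_mem_support, Finsupp.mem_support_iff, Finsupp.add_apply] at h
  simp only [Finsupp.mem_support_iff]
  omega

theorem single_injective : Function.Injective fun j : Fin n => Finsupp.single j (1 : ℕ) :=
  Finsupp.single_left_injective one_ne_zero

theorem IsMinFullyAttached.two_le_length {t : List (Fin n →₀ ℕ)}
    (h : IsMinFullyAttached a t) : 2 ≤ t.length := by
  match t, h with
  | _ :: _ :: _, _ => simp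

theorem isMinFullyAttached_pair_iff {x w : Fin n →₀ ℕ} :
    IsMinFullyAttached a [x, w] ↔ ∃ i : Fin n, x = Finsupp.single i 1 ∧
      Finsupp.single i 1 ∈ standardMonomials a ∧ w ∈ standardMonomials a ∧
      Finsupp.single i 1 + w ∈ minGenInitial a ∧ ∀ j ∈ w.support, i ≤ j := by
  constructor
  · rintro ⟨i, w₂, h, h1⟩
    simp only [List.cons.injEq, and_true] at h
    obtain ⟨rfl, rfl⟩ := h
    exact ⟨i, rfl, h1⟩
  · rintro ⟨i, rfl, h⟩
    exact ⟨i, w, rfl, h⟩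

theorem AttachingCondition.congr {prev prev' : List (Fin n →₀ ℕ) → Prop}
    {pre : List (Fin n →₀ ℕ)} (h : ∀ u, prev (pre ++ [u]) ↔ prev' (pre ++ [u]))
    (b c : Fin n →₀ ℕ) :
    AttachingCondition a prev pre b c ↔ AttachingCondition a prev' pre b c := by
  simp only [AttachingCondition, h]

/-- Removes the length index from the recursion: every candidate `pre ++ [u]` has the same length.
-/
theorem isMinFullyAttached_append_iff {pre : List (Fin n →₀ ℕ)} {b c : Fin n →₀ ℕ}
    (hpre : pre ≠ []) :
    IsMinFullyAttached a (pre ++ [b, c]) ↔ IsMinFullyAttached a (pre ++ [b]) ∧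
      c ∈ standardMonomials a ∧
      (∃ i : Fin n, pre.head? = some (Finsupp.single i 1) ∧ ∀ j ∈ c.support, i < j) ∧
      AttachingCondition a (IsMinFullyAttached a) pre b c ∧
      ∀ c' : Fin n →₀ ℕ, c' ≤ c → c' ≠ c →
        ¬ AttachingCondition a (IsMinFullyAttached a) pre b c' := by
  obtain ⟨l, hl⟩ : ∃ l, pre.length = l + 1 :=
    ⟨pre.length - 1, by have := List.length_pos_iff.2 hpre; omega⟩
  have h1 : ∀ u, IsMinFullyAttached a (pre ++ [u]) ↔
      IsMinFullyAttachedOfLength a (l + 2) (pre ++ [u]) := fun u => by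
    rw [IsMinFullyAttached, List.length_append, hl]
    rfl
  have h2 : IsMinFullyAttached a (pre ++ [b, c]) ↔
      IsMinFullyAttachedOfLength a (l + 3) (pre ++ [b, c]) := by
    rw [IsMinFullyAttached, List.length_append, hl]
    rfl
  rw [h2, h1]
  simp only [AttachingCondition.congr h1]
  constructor
  · rintro ⟨pre', b', c', he, h⟩
    obtain ⟨rfl, h3⟩ := List.append_inj' he rfl
    simp only [List.cons.injEq, and_true] at h3
    obtain ⟨rfl, rfl⟩ := h3
    exact h
  · intro h
    exact ⟨pre, b, c, rfl, h⟩

theorem IsMinFullyAttached.last_mem {t : List (Fin n →₀ ℕ)} {c : Fin n →₀ ℕ}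
    (h : IsMinFullyAttached a (t ++ [c])) : c ∈ standardMonomials a := by
  rcases List.eq_nil_or_concat' t with rfl | ⟨pre, b, rfl⟩
  · exact absurd h.two_le_length (by simp)
  · by_cases hpre : pre = []
    · subst hpre
      obtain ⟨i, rfl, -, h2, -⟩ := isMinFullyAttached_pair_iff.1 h
      exact h2
    · rw [List.append_assoc] at h
      exact ((isMinFullyAttached_append_iff hpre).1 h).2.1

theorem IsMinFullyAttached.exists_headD {t : List (Fin n →₀ ℕ)} {c : Fin n →₀ ℕ}
    (h : IsMinFullyAttached a (t ++ [c])) : ∃ i : Fin n, t.headD 0 = Finsupp.single i 1 ∧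
      (∀ j ∈ c.support, i ≤ j) ∧ (t.length ≠ 1 → ∀ j ∈ c.support, i < j) ∧
      (t.length = 1 → t = [Finsupp.single i 1] ∧
        Finsupp.single i 1 + c ∈ initialMonomials a) := by
  rcases List.eq_nil_or_concat' t with rfl | ⟨pre, b, rfl⟩
  · exact absurd h.two_le_length (by simp)
  · by_cases hpre : pre = []
    · subst hpre
      obtain ⟨i, rfl, -, -, h3, h4⟩ := isMinFullyAttached_pair_iff.1 h
      exact ⟨i, rfl, h4, fun h => absurd rfl h, fun _ => ⟨rfl, h3.1⟩⟩
    · rw [List.append_assoc] at h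
      obtain ⟨-, -, ⟨i, hi, hj⟩, -⟩ := (isMinFullyAttached_append_iff hpre).1 h
      refine ⟨i, ?_, fun j h => (hj j h).le, fun _ => hj, fun h => ?_⟩
      · obtain ⟨x, s, rfl⟩ := List.exists_cons_of_ne_nil hpre
        simpa using hi
      · have := List.length_pos_iff.2 hpre
        rw [List.length_append, List.length_singleton] at h
        omega

/-- A new block may start with the letter `u` after the block `t`. -/
def CanStart (t : List (Fin n →₀ ℕ)) (u : Fin n →₀ ℕ) : Prop :=
  t.headD 0 ≼[MonomialOrder.degLex] u ∧ (t.length = 1 → t.headD 0 ≺[MonomialOrder.degLex] u)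

/-- A variable able to start a block after `t` is at least the head of `t`, strictly larger if `t`
is a single variable, whereas the variables of an extending entry are bounded in the opposite
direction. -/
theorem IsMinFullyAttached.notMem_support {t : List (Fin n →₀ ℕ)} {c : Fin n →₀ ℕ}
    (h : IsMinFullyAttached a (t ++ [c])) {j : Fin n} (hj : CanStart t (Finsupp.single j 1)) :
    j ∉ c.support := by
  intro hjc
  obtain ⟨i, hi, h1, h2, -⟩ := h.exists_headD
  rw [CanStart, hi] at hj
  by_cases hl : t.length = 1
  · have h3 := MonomialOrder.degLex_single_lt_iff.1 (hj.2 hl)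
    exact absurd (h1 j hjc) (not_le.2 h3)
  · have h3 := MonomialOrder.degLex_single_le_iff.1 hj.1
    exact absurd (h2 hl j hjc) (not_lt.2 h3)

/-- The two kinds of letters are disjoint, so cutting a cell into blocks is unambiguous. -/
theorem not_isMinFullyAttached_of_canStart {t : List (Fin n →₀ ℕ)} {j : Fin n}
    (hj : CanStart t (Finsupp.single j 1)) :
    ¬ IsMinFullyAttached a (t ++ [Finsupp.single j 1]) := fun h =>
  h.notMem_support hj (by simp)

open Classical in
/-- The decomposition of a cell into blocks, the last block coming first. -/
noncomputable def blocks (a : Ideal (MvPolynomial (Fin n) k)) :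
    List (Fin n →₀ ℕ) → List (List (Fin n →₀ ℕ))
  | [] => []
  | u :: c =>
    if IsMinFullyAttached a ((blocks a c).headD [] ++ [u]) then
      ((blocks a c).headD [] ++ [u]) :: (blocks a c).tail
    else [u] :: blocks a c

/-- The last block of a cell. -/
noncomputable def lastBlock (a : Ideal (MvPolynomial (Fin n) k)) (c : List (Fin n →₀ ℕ)) :
    List (Fin n →₀ ℕ) :=
  (blocks a c).headD []

theorem lastBlock_cons_of_pos {c : List (Fin n →₀ ℕ)} {u : Fin n →₀ ℕ}
    (h : IsMinFullyAttached a (lastBlock a c ++ [u])) :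
    lastBlock a (u :: c) = lastBlock a c ++ [u] := by
  rw [lastBlock, blocks, if_pos (by exact h)]
  rfl

theorem lastBlock_cons_of_neg {c : List (Fin n →₀ ℕ)} {u : Fin n →₀ ℕ}
    (h : ¬ IsMinFullyAttached a (lastBlock a c ++ [u])) : lastBlock a (u :: c) = [u] := by
  rw [lastBlock, blocks, if_neg (by exact h)]
  rfl

/-- The letters that can be appended to a cell: those that extend the last block to a minimal
fully attached tuple, and variables that start a new block. -/
def attachedLetters (a : Ideal (MvPolynomial (Fin n) k)) (c : List (Fin n →₀ ℕ)) :
    Set (Fin n →₀ ℕ) :=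
  {u | IsMinFullyAttached a (lastBlock a c ++ [u]) ∨ ∃ j : Fin n, u = Finsupp.single j 1 ∧
    Finsupp.single j 1 ∈ standardMonomials a ∧ CanStart (lastBlock a c) (Finsupp.single j 1)}

/-- Letters starting a new block have priority over letters extending the last one; among letters
of the same kind, larger ones have priority. -/
def attachedPrior (a : Ideal (MvPolynomial (Fin n) k)) (c : List (Fin n →₀ ℕ))
    (u u' : Fin n →₀ ℕ) : Prop :=
  (¬ IsMinFullyAttached a (lastBlock a c ++ [u]) ∧ IsMinFullyAttached a (lastBlock a c ++ [u'])) ∨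
  ((IsMinFullyAttached a (lastBlock a c ++ [u]) ↔ IsMinFullyAttached a (lastBlock a c ++ [u'])) ∧
    u' ≺[MonomialOrder.degLex] u)

theorem mem_standardMonomials_of_mem_attachedLetters {c : List (Fin n →₀ ℕ)} {u : Fin n →₀ ℕ}
    (h : u ∈ attachedLetters a c) : u ∈ standardMonomials a := by
  rcases h with h | ⟨j, rfl, h, -⟩
  · exact h.last_mem
  · exact h

/-- For two consecutive letters `g`, `u`, either `g u` is reducible or a letter of higher priority
than `g` divides `g u`; the cases are whether each of them starts or extends a block. -/
theorem attachedLetters_subset_colonSet (c : List (Fin n →₀ ℕ))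
    (hc : IsCell (attachedLetters a) c) : attachedLetters a c ⊆
      colonSet (initialMonomials a) (attachedLetters a) (attachedPrior a) c := by
  intro u hu
  match c, hc with
  | [], _ => exact (mem_standardMonomials_of_mem_attachedLetters hu).1
  | g :: b, hc =>
    change g + u ∈ initialMonomials a ∨ ∃ u' ∈ attachedLetters a b,
      attachedPrior a b u' g ∧ u' ≤ g + u
    by_cases hg : IsMinFullyAttached a (lastBlock a b ++ [g])
    · rw [attachedLetters, lastBlock_cons_of_pos hg] at hu
      obtain ⟨i, hi, -, -, hI⟩ := hg.exists_headD
      have hne : lastBlock a b ≠ [] := by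
        intro h
        rw [h] at hi
        exact Finsupp.single_ne_zero.2 one_ne_zero hi.symm
      rcases hu with hu | ⟨j, rfl, hj, hst⟩
      · rw [List.append_assoc] at hu
        obtain ⟨-, -, -, h | ⟨-, u', v', he, hlt, hu'⟩, -⟩ :=
          (isMinFullyAttached_append_iff hne).1 hu
        · exact Or.inl h
        -- The second attaching condition supplies a larger extending letter, which has priority
        -- over `g`.
        · refine Or.inr ⟨u', Or.inl hu', Or.inr ⟨⟨fun _ => hg, fun _ => hu'⟩, hlt⟩, ?_⟩
          rw [he]
          exact le_self_add
      · have hhead : (lastBlock a b ++ [g]).headD 0 = Finsupp.single i 1 := by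
          obtain ⟨x, s, h⟩ := List.exists_cons_of_ne_nil hne
          rw [h] at hi ⊢
          exact hi
        have hji : j ≤ i := by
          have := hst.1
          rwa [hhead, MonomialOrder.degLex_single_le_iff] at this
        -- If `x_j` could already have started a block in place of `g`, it has priority. Otherwise
        -- the block before `g` is the single variable `x_i` with `j = i`, and `x_i g` is reducible.
        by_cases hcs : CanStart (lastBlock a b) (Finsupp.single j 1)
        · exact Or.inr ⟨_, Or.inr ⟨j, rfl, hj, hcs⟩,
            Or.inl ⟨not_isMinFullyAttached_of_canStart hcs, hg⟩, le_add_self⟩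
        · have hl : (lastBlock a b).length = 1 := by
            by_contra hl
            refine hcs ⟨?_, fun h => absurd h hl⟩
            rwa [hi, MonomialOrder.degLex_single_le_iff]
          have hij : j = i := by
            by_contra hne
            refine hcs ⟨?_, fun _ => ?_⟩
            · rwa [hi, MonomialOrder.degLex_single_le_iff]
            · rw [hi, MonomialOrder.degLex_single_lt_iff]
              exact lt_of_le_of_ne hji hne
          rw [hij, add_comm]
          exact Or.inl (hI hl).2
    · rw [attachedLetters, lastBlock_cons_of_neg hg] at hu
      obtain ⟨m, rfl, hm, hst⟩ := hc.2.resolve_left hg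
      rcases hu with hu | ⟨j, rfl, hj, hst'⟩
      · obtain ⟨i, hi, -, -, hI, -⟩ := isMinFullyAttached_pair_iff.1 hu
        rw [hi]
        exact Or.inl hI.1
      · have hlt : Finsupp.single m 1 ≺[MonomialOrder.degLex] Finsupp.single j 1 := hst'.2 rfl
        have hcs : CanStart (lastBlock a b) (Finsupp.single j 1) :=
          ⟨hst.1.trans hlt.le, fun _ => hst.1.trans_lt hlt⟩
        refine Or.inr ⟨_, Or.inr ⟨j, rfl, hj, hcs⟩, Or.inr ⟨?_, hlt⟩, le_add_self⟩
        exact ⟨fun h => absurd h (not_isMinFullyAttached_of_canStart hcs), fun h => absurd h hg⟩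

theorem exists_minGenInitial_le {w : Fin n →₀ ℕ} (hw : w ∈ initialMonomials a) :
    ∃ q ∈ minGenInitial a, q ≤ w := by
  obtain ⟨q, hq, hmin⟩ := exists_minimal_le_of_wellFoundedLT
    (fun v => v ∈ initialMonomials a) w hw
  exact ⟨q, hmin, hq⟩

/-- If some variable dividing `w` can start a block, it is the required letter. Otherwise all
variables of `w` are small enough for an extension, and `w` satisfies the attaching condition (or
completes the variable `g` to a reducible monomial), so a minimal divisor of `w` is found. -/
theorem exists_attachedLetter_le (c : List (Fin n →₀ ℕ)) (hc : IsCell (attachedLetters a) c)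
    (w : Fin n →₀ ℕ)
    (hw : w ∈ colonSet (initialMonomials a) (attachedLetters a) (attachedPrior a) c)
    (hI : w ∉ initialMonomials a) : ∃ u ∈ attachedLetters a c, u ≤ w := by
  have hstd : ∀ u, u ≠ 0 → u ≤ w → u ∈ standardMonomials a := fun u h0 hu =>
    ⟨h0, fun h => hI (mem_initialMonomials_of_le h hu)⟩
  by_cases hcs : ∃ j ∈ w.support, CanStart (lastBlock a c) (Finsupp.single j 1)
  · obtain ⟨j, hj, hj'⟩ := hcs
    have hle := single_le_iff_mem_support.2 hj
    exact ⟨_, Or.inr ⟨j, rfl, hstd _ (Finsupp.single_ne_zero.2 one_ne_zero) hle, hj'⟩, hle⟩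
  push Not at hcs
  match c, hc with
  | [], _ =>
    exfalso
    obtain ⟨j, hj⟩ := Finsupp.support_nonempty_iff.2 (show w ≠ 0 from hw)
    refine hcs j hj ⟨?_, fun h => ?_⟩
    -- For the empty cell the default head is the monomial `1`, which is smallest, so every variable
    -- can start a block.
    · change MonomialOrder.degLex.toSyn 0 ≤ _
      rw [map_zero]
      exact MonomialOrder.zero_le _ _
    · exact absurd h (by simp [lastBlock, blocks])
  | g :: b, hc =>
    change g + w ∈ initialMonomials a ∨ ∃ u' ∈ attachedLetters a b,
      attachedPrior a b u' g ∧ u' ≤ g + w at hw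
    by_cases hg : IsMinFullyAttached a (lastBlock a b ++ [g])
    · rw [lastBlock_cons_of_pos hg] at hcs
      obtain ⟨i, hi, -, -, -⟩ := hg.exists_headD
      have hne : lastBlock a b ≠ [] := by
        intro h
        rw [h] at hi
        exact Finsupp.single_ne_zero.2 one_ne_zero hi.symm
      obtain ⟨x, s, hxs⟩ := List.exists_cons_of_ne_nil hne
      have hx : x = Finsupp.single i 1 := by
        rw [hxs] at hi
        exact hi
      have hsupp : ∀ j ∈ w.support, i < j := by
        intro j hj
        by_contra hji
        refine hcs j hj ⟨?_, fun h => ?_⟩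
        · rw [hxs]
          change x ≼[MonomialOrder.degLex] _
          rw [hx, MonomialOrder.degLex_single_le_iff]
          exact not_lt.1 hji
        · have := hg.two_le_length
          omega
      have hatt : AttachingCondition a (IsMinFullyAttached a) (lastBlock a b) g w := by
        by_cases hgw : g + w ∈ initialMonomials a
        · exact Or.inl hgw
        obtain ⟨u', hu', hp, hle⟩ := hw.resolve_left hgw
        have hgw' : g + w ∈ standardMonomials a :=
          ⟨fun h => hg.last_mem.1 (add_eq_zero.1 h).1, hgw⟩
        -- A starting variable dividing `g w` would have to divide `g` or `w`; neither is possible,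
        -- so the letter with priority is an extending one larger than `g`.
        rcases hp with ⟨hu'', -⟩ | ⟨he, hlt⟩
        · exfalso
          obtain ⟨l, rfl, -, hl⟩ := hu'.resolve_left hu''
          rcases mem_support_of_single_le_add hle with h | h
          · exact hg.notMem_support hl h
          · have h1 := hl.1
            rw [hi, MonomialOrder.degLex_single_le_iff] at h1
            exact absurd (hsupp l h) (not_lt.2 h1)
        · obtain ⟨v, hv⟩ := exists_add_of_le hle
          exact Or.inr ⟨hgw', u', v, hv, hlt, he.2 hg⟩
      obtain ⟨q, hq, hmin⟩ := exists_minimal_le_of_wellFoundedLT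
        (fun v => AttachingCondition a (IsMinFullyAttached a) (lastBlock a b) g v) w hatt
      have hq0 : q ≠ 0 := by
        rintro rfl
        rcases hmin.1 with h | ⟨-, u', v', he, hlt, -⟩
        · rw [add_zero] at h
          exact hg.last_mem.2 h
        · rw [add_zero] at he
          rw [he] at hlt
          exact absurd (MonomialOrder.degLex.toSyn_monotone (le_self_add (a := u') (b := v')))
            (not_le.2 hlt)
      refine ⟨q, Or.inl ?_, hq⟩
      rw [lastBlock_cons_of_pos hg, List.append_assoc]
      refine (isMinFullyAttached_append_iff hne).2 ⟨hg, hstd q hq0 hq, ⟨i, ?_, ?_⟩, hmin.1, ?_⟩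
      · rw [hxs, hx, List.head?_cons]
      · exact fun j hj => hsupp j (Finsupp.support_mono hq hj)
      · exact fun c' hc' hne' h => hne' (le_antisymm hc' (hmin.2 h hc'))
    · rw [lastBlock_cons_of_neg hg] at hcs
      obtain ⟨m, rfl, hm, hst⟩ := hc.2.resolve_left hg
      have hsupp : ∀ j ∈ w.support, m ≤ j := by
        intro j hj
        by_contra hjm
        have hlt := MonomialOrder.degLex_single_lt_iff.2 (not_le.1 hjm)
        exact hcs j hj ⟨hlt.le, fun _ => hlt⟩
      have hmw : Finsupp.single m 1 + w ∈ initialMonomials a := by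
        refine hw.resolve_right ?_
        rintro ⟨u', hu', hp, hle⟩
        rcases hp with ⟨-, h⟩ | ⟨he, hlt⟩
        · exact hg h
        · obtain ⟨l, rfl, -, -⟩ := hu'.resolve_left fun h => hg (he.1 h)
          rw [MonomialOrder.degLex_single_lt_iff] at hlt
          rcases mem_support_of_single_le_add hle with h | h
          · rw [Finsupp.mem_support_iff, Finsupp.single_apply_ne_zero] at h
            exact hlt.ne h.1
          · exact absurd (hsupp l h) (not_le.2 hlt)
      obtain ⟨q, hq, hqle⟩ := exists_minGenInitial_le hmw
      -- A generator not divisible by `x_m` would already divide the irreducible monomial `w`.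
      have hmq : Finsupp.single m 1 ≤ q := by
        by_contra h
        rw [single_le_iff_mem_support, Finsupp.notMem_support_iff] at h
        refine hI (mem_initialMonomials_of_le hq.1 fun j => ?_)
        have h1 := hqle j
        rw [Finsupp.add_apply] at h1
        by_cases hj : m = j
        · subst hj
          omega
        · rwa [Finsupp.single_eq_of_ne (Ne.symm hj), zero_add] at h1
      obtain ⟨v, rfl⟩ := exists_add_of_le hmq
      have hv : v ≤ w := le_of_add_le_add_left hqle
      have hv0 : v ≠ 0 := by
        rintro rfl
        rw [add_zero] at hq
        exact hm.2 hq.1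
      refine ⟨v, Or.inl ?_, hv⟩
      rw [lastBlock_cons_of_neg hg]
      exact isMinFullyAttached_pair_iff.2 ⟨m, rfl, hm, hstd v hv0 hv, hq,
        fun j hj => hsupp j (Finsupp.support_mono hv hj)⟩

/-- The letter system of minimal fully attached tuples. -/
noncomputable def attachedSystem (a : Ideal (MvPolynomial (Fin n) k)) :
    LetterSystem (initialMonomials a) where
  letters := attachedLetters a
  prior := attachedPrior a
  prior_trans := by
    rintro c x y z (⟨h1, h2⟩ | ⟨h1, h2⟩) (⟨h3, h4⟩ | ⟨h3, h4⟩)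
    · exact absurd h2 h3
    · exact Or.inl ⟨h1, h3.1 h2⟩
    · exact Or.inl ⟨fun h => h3 (h1.1 h), h4⟩
    · exact Or.inr ⟨h1.trans h3, h4.trans h2⟩
  prior_irrefl := by
    rintro c x (⟨h1, h2⟩ | ⟨-, h⟩)
    · exact h1 h2
    · exact lt_irrefl _ h
  prior_total := by
    intro c x y
    by_cases hx : IsMinFullyAttached a (lastBlock a c ++ [x]) <;>
    by_cases hy : IsMinFullyAttached a (lastBlock a c ++ [y])
    · rcases lt_trichotomy (MonomialOrder.degLex.toSyn x) (MonomialOrder.degLex.toSyn y) with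
        h | h | h
      · exact Or.inr (Or.inr (Or.inr ⟨iff_of_true hy hx, h⟩))
      · exact Or.inr (Or.inl (MonomialOrder.degLex.toSyn.injective h))
      · exact Or.inl (Or.inr ⟨iff_of_true hx hy, h⟩)
    · exact Or.inr (Or.inr (Or.inl ⟨hy, hx⟩))
    · exact Or.inl (Or.inl ⟨hx, hy⟩)
    · rcases lt_trichotomy (MonomialOrder.degLex.toSyn x) (MonomialOrder.degLex.toSyn y) with
        h | h | h
      · exact Or.inr (Or.inr (Or.inr ⟨iff_of_false hy hx, h⟩))
      · exact Or.inr (Or.inl (MonomialOrder.degLex.toSyn.injective h))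
      · exact Or.inl (Or.inr ⟨iff_of_false hx hy, h⟩)
  letters_subset := attachedLetters_subset_colonSet
  exists_letter_le := exists_attachedLetter_le

end AttachedTuples


/-! ### Counting cells -/

section Counting

variable {k : Type u} [Field k] {n : ℕ} {a : Ideal (MvPolynomial (Fin n) k)}

/-- A list of blocks is determined by the blocks of length different from one, in their order, and
the set of blocks of length one, if it is suitably sorted. -/
theorem eq_of_filter_eq_of_mem_iff {α : Type*} {p : α → Bool} {r : α → α → Prop}
    (hr : ∀ s t, p t = false → r s t → ¬ r t s) :
    ∀ {B B' : List α}, B.Pairwise r → B'.Pairwise r → B.filter p = B'.filter p →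
      (∀ t, p t = false → (t ∈ B ↔ t ∈ B')) → B = B'
  | [], [], _, _, _, _ => rfl
  | [], t :: B', _, _, h1, h2 => by
    by_cases ht : p t
    · simp [ht] at h1
    · simpa using h2 t (by simpa using ht)
  | t :: B, [], _, _, h1, h2 => by
    by_cases ht : p t
    · simp [ht] at h1
    · simpa using h2 t (by simpa using ht)
  | t :: B, t' :: B', hB, hB', h1, h2 => by
    rw [List.pairwise_cons] at hB hB'
    -- If the first entries differed with `t` outside the filter, each would occur in the tail of
    -- the other list, giving both `r t t'` and `r t' t`.
    have key : ∀ (t t' : α) (B B' : List α), (∀ s ∈ B, r t s) → (∀ s ∈ B', r t' s) →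
        (t :: B).filter p = (t' :: B').filter p →
        (∀ s, p s = false → (s ∈ t :: B ↔ s ∈ t' :: B')) → p t = false → t = t' := by
      intro t t' B B' hB hB' h1 h2 ht
      by_contra hne
      have h3 : t ∈ B' := by
        have := (h2 t ht).1 List.mem_cons_self
        rw [List.mem_cons] at this
        exact this.resolve_left hne
      have h4 : t' ∈ B := by
        have : t' ∈ t :: B := by
          by_cases ht' : p t'
          · have h5 : t' ∈ (t' :: B').filter p := List.mem_filter.2 ⟨List.mem_cons_self, ht'⟩
            rw [← h1] at h5
            exact (List.mem_filter.1 h5).1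
          · exact (h2 t' (by simpa using ht')).2 List.mem_cons_self
        rw [List.mem_cons] at this
        exact this.resolve_left fun h => hne h.symm
      exact hr _ _ ht (hB' t h3) (hB t' h4)
    have htt : t = t' := by
      by_cases ht : p t
      · by_cases ht' : p t'
        · rw [List.filter_cons_of_pos ht, List.filter_cons_of_pos ht'] at h1
          exact (List.cons.inj h1).1
        · exact (key t' t B' B hB'.1 hB.1 h1.symm (fun s hs => (h2 s hs).symm)
            (by simpa using ht')).symm
      · exact key t t' B B' hB.1 hB'.1 h1 h2 (by simpa using ht)
    subst htt
    congr 1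
    refine eq_of_filter_eq_of_mem_iff hr hB.2 hB'.2 ?_ fun s hs => ?_
    · by_cases ht : p t
      · rw [List.filter_cons_of_pos ht, List.filter_cons_of_pos ht] at h1
        exact (List.cons.inj h1).2
      · rwa [List.filter_cons_of_neg ht, List.filter_cons_of_neg ht] at h1
    · by_cases hst : s = t
      · subst hst
        have hirr : ¬ r s s := fun h => hr s s hs h h
        exact iff_of_false (fun h => hirr (hB.1 s h)) (fun h => hirr (hB'.1 s h))
      · have := h2 s hs
        simpa [hst] using this

/-- The order relation between a block and an earlier one. -/
def BlockRel (t t' : List (Fin n →₀ ℕ)) : Prop :=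
  t'.headD 0 ≼[MonomialOrder.degLex] t.headD 0 ∧
    (t'.length = 1 → t'.headD 0 ≺[MonomialOrder.degLex] t.headD 0)

theorem BlockRel.trans {t t' t'' : List (Fin n →₀ ℕ)} (h1 : BlockRel t t')
    (h2 : BlockRel t' t'') : BlockRel t t'' :=
  ⟨h2.1.trans h1.1, fun h => (h2.2 h).trans_le h1.1⟩

/-- A valid block is a variable or a minimal fully attached tuple. -/
def IsBlock (a : Ideal (MvPolynomial (Fin n) k)) (t : List (Fin n →₀ ℕ)) : Prop :=
  (∃ j : Fin n, t = [Finsupp.single j 1]) ∨ IsMinFullyAttached a t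

theorem flatten_blocks (c : List (Fin n →₀ ℕ)) :
    (blocks a c).reverse.flatten = c.reverse := by
  induction c with
  | nil => rfl
  | cons u c ih =>
    rw [blocks, List.reverse_cons, ← ih]
    split_ifs
    · cases blocks a c <;> simp
    · simp

theorem blocks_injective : Function.Injective (blocks a) := fun c c' h => by
  rw [← List.reverse_inj, ← flatten_blocks (a := a), h, flatten_blocks]

theorem isBlock_of_mem_blocks {c : List (Fin n →₀ ℕ)} (hc : IsCell (attachedLetters a) c) :
    ∀ t ∈ blocks a c, IsBlock a t := by
  induction c with
  | nil => simp [blocks]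
  | cons u c ih =>
    rw [blocks]
    split_ifs with h
    · rintro t ht
      rcases List.mem_cons.1 ht with rfl | ht
      · exact Or.inr h
      · exact ih hc.1 t (List.mem_of_mem_tail ht)
    · rintro t ht
      rcases List.mem_cons.1 ht with rfl | ht
      · obtain ⟨j, rfl, -⟩ := hc.2.resolve_left h
        exact Or.inl ⟨j, rfl⟩
      · exact ih hc.1 t ht

/-- Extending the newest block changes neither its head nor anything about the earlier blocks, and
`BlockRel` looks only at the head of the later block. For a new block the relation to its
predecessor is `CanStart`, and transitivity gives the rest. -/
theorem pairwise_blocks {c : List (Fin n →₀ ℕ)} (hc : IsCell (attachedLetters a) c) :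
    (blocks a c).Pairwise BlockRel := by
  induction c with
  | nil => simp [blocks]
  | cons u c ih =>
    have ih := ih hc.1
    rw [blocks]
    split_ifs with h
    · cases hB : blocks a c with
      | nil => simp
      | cons t W =>
        rw [hB] at h ih
        rw [List.pairwise_cons] at ih
        change IsMinFullyAttached a (t ++ [u]) at h
        have ht : (t ++ [u]).headD 0 = t.headD 0 := by
          cases t with
          | nil => exact absurd h.two_le_length (by simp)
          | cons x s => rfl
        simp only [List.headD_cons, List.tail_cons, List.pairwise_cons]
        refine ⟨fun t' ht' => ?_, ih.2⟩
        have := ih.1 t' ht'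
        rwa [BlockRel, ← ht] at this
    · obtain ⟨j, rfl, -, hst⟩ := hc.2.resolve_left h
      rw [List.pairwise_cons]
      refine ⟨?_, ih⟩
      rw [lastBlock] at hst
      cases hB : blocks a c with
      | nil => simp
      | cons t W =>
        rw [hB] at hst ih
        have h1 : BlockRel [Finsupp.single j 1] t := hst
        intro t' ht'
        rcases List.mem_cons.1 ht' with rfl | ht'
        · exact h1
        · exact h1.trans ((List.pairwise_cons.1 ih).1 t' ht')

open Classical in
/-- The variables that form a block of their own. -/
noncomputable def singleBlocks (a : Ideal (MvPolynomial (Fin n) k)) (c : List (Fin n →₀ ℕ)) :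
    Finset (Fin n) :=
  Finset.univ.filter fun j => [Finsupp.single j 1] ∈ blocks a c

/-- The word of minimal fully attached tuples of a cell. -/
noncomputable def cellWord (a : Ideal (MvPolynomial (Fin n) k)) (c : List (Fin n →₀ ℕ)) :
    List (List (Fin n →₀ ℕ)) :=
  ((blocks a c).filter fun t => t.length ≠ 1).reverse

theorem cellWord_mem_language {c : List (Fin n →₀ ℕ)} (hc : IsCell (attachedLetters a) c) :
    cellWord a c ∈ language a := by
  refine ⟨fun p hp => ?_, ?_⟩
  · rw [cellWord, List.mem_reverse, List.mem_filter] at hp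
    refine (isBlock_of_mem_blocks hc p hp.1).resolve_left ?_
    rintro ⟨j, rfl⟩
    simp at hp
  · refine List.Pairwise.isChain ?_
    rw [cellWord, List.pairwise_reverse]
    refine ((pairwise_blocks hc).filter _).imp ?_
    rintro q p h ⟨x, y, s, t, rfl, rfl, hlt⟩
    exact absurd h.1 (not_le.2 hlt)

/-- The strict inequality after a one-variable block fixes its position among the other blocks, so
the set of these variables and the word recover the list of blocks. -/
theorem cell_eq_of_cellWord_eq {c c' : List (Fin n →₀ ℕ)} (hc : IsCell (attachedLetters a) c)
    (hc' : IsCell (attachedLetters a) c') (hJ : singleBlocks a c = singleBlocks a c')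
    (hW : cellWord a c = cellWord a c') : c = c' := by
  refine blocks_injective (a := a) (eq_of_filter_eq_of_mem_iff (p := fun t : List (Fin n →₀ ℕ) => decide (t.length ≠ 1))
    (r := BlockRel) ?_ (pairwise_blocks hc) (pairwise_blocks hc') (List.reverse_inj.1 hW) ?_)
  · intro s t ht h1 h2
    exact absurd h2.1 (not_le.2 (h1.2 (by simpa using ht)))
  · have key : ∀ {c c' : List (Fin n →₀ ℕ)}, IsCell (attachedLetters a) c →
        singleBlocks a c = singleBlocks a c' → ∀ t : List (Fin n →₀ ℕ), t.length = 1 →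
        t ∈ blocks a c → t ∈ blocks a c' := by
      intro c c' hc hJ t ht htc
      rcases isBlock_of_mem_blocks hc t htc with ⟨j, rfl⟩ | h
      · have : j ∈ singleBlocks a c := Finset.mem_filter.2 ⟨Finset.mem_univ _, htc⟩
        rw [hJ] at this
        exact (Finset.mem_filter.1 this).2
      · have := h.two_le_length
        omega
    intro t ht
    have ht' : t.length = 1 := by simpa using ht
    exact ⟨key hc hJ t ht', key hc' hJ.symm t ht'⟩

/-- An additive function on blocks, summed over a cell. -/
theorem sum_map_blocks {c : List (Fin n →₀ ℕ)} (hc : IsCell (attachedLetters a) c)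
    {N : Type*} [AddCommMonoid N] (f : List (Fin n →₀ ℕ) → N) :
    ((blocks a c).map f).sum =
      ∑ j ∈ singleBlocks a c, f [Finsupp.single j 1] + ((cellWord a c).map f).sum := by
  classical
  have h1 : ∀ B : List (List (Fin n →₀ ℕ)), (B.map f).sum =
      ((B.filter fun t => t.length = 1).map f).sum +
      ((B.filter fun t => t.length ≠ 1).map f).sum := by
    intro B
    induction B with
    | nil => simp
    | cons t B ih =>
      by_cases ht : t.length = 1
      · simp [ht, ih, add_assoc]
      · simp [ht, ih, add_left_comm]
  -- A one-variable block cannot repeat, again by strictness; hence a set of variables, and factors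
  -- `1 + x_i t`.
  have h2 : ((blocks a c).filter fun t => t.length = 1).Nodup := by
    refine List.Pairwise.imp_of_mem ?_ ((pairwise_blocks hc).filter _)
    rintro s t hs - h rfl
    have hs1 : s.length = 1 := by simpa using (List.mem_filter.1 hs).2
    exact lt_irrefl _ (h.2 hs1)
  have h3 : ((blocks a c).filter fun t => t.length = 1).toFinset =
      (singleBlocks a c).map ⟨fun j => [Finsupp.single j 1], fun i j h => by
        exact single_injective (List.cons.inj h).1⟩ := by
    ext t
    simp only [List.mem_toFinset, List.mem_filter, decide_eq_true_eq, Finset.mem_map,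
      singleBlocks, Finset.mem_filter, Finset.mem_univ, true_and]
    constructor
    · rintro ⟨ht, hl⟩
      rcases isBlock_of_mem_blocks hc t ht with ⟨j, rfl⟩ | h
      · exact ⟨j, ht, rfl⟩
      · have := h.two_le_length
        omega
    · rintro ⟨j, hj, rfl⟩
      exact ⟨hj, rfl⟩
  rw [h1, cellWord, List.map_reverse, List.sum_reverse, ← List.sum_toFinset _ h2, h3,
    Finset.sum_map]
  rfl

theorem sum_cell {c : List (Fin n →₀ ℕ)} (hc : IsCell (attachedLetters a) c) :
    c.sum = ∑ j ∈ singleBlocks a c, Finsupp.single j 1 + wordMonomial (cellWord a c) := by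
  have h := sum_map_blocks hc List.sum
  rw [← List.sum_reverse, ← List.map_reverse, ← List.sum_flatten, flatten_blocks,
    List.sum_reverse] at h
  simpa [wordMonomial] using h

theorem length_cell {c : List (Fin n →₀ ℕ)} (hc : IsCell (attachedLetters a) c) :
    c.length = (singleBlocks a c).card + wordLength (cellWord a c) := by
  have h := sum_map_blocks hc List.length
  rw [← List.sum_reverse, ← List.map_reverse, ← List.length_flatten, flatten_blocks,
    List.length_reverse] at h
  simpa [wordLength] using h

/-! ### Finiteness of tuples, words and cells. -/

/-- Dickson's lemma: antichains for divisibility are finite. -/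
theorem finite_setOf_minimal (P : (Fin n →₀ ℕ) → Prop) : {w | Minimal P w}.Finite :=
  WellQuasiOrderedLE.finite_of_isAntichain (setOfPred_minimal_antichain P)

theorem finite_isMinFullyAttachedOfLength (a : Ideal (MvPolynomial (Fin n) k)) (l : ℕ) :
    {t | IsMinFullyAttachedOfLength a l t}.Finite := by
  match l with
  | 0 => exact Set.finite_empty.subset fun t h => h
  | 1 => exact Set.finite_empty.subset fun t h => h
  | 2 =>
    have h1 : (minGenInitial a).Finite := finite_setOf_minimal _
    refine ((Set.finite_univ (α := Fin n)).image2
      (fun i q => [Finsupp.single i 1, q - Finsupp.single i 1]) h1).subset ?_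
    rintro t ⟨i, w, rfl, -, -, h, -⟩
    exact ⟨i, trivial, _, h, by simp⟩
  | l + 3 =>
    have ih := finite_isMinFullyAttachedOfLength a (l + 2)
    refine (ih.biUnion (t := fun s => (fun c => s ++ [c]) '' {c | Minimal
      (AttachingCondition a (IsMinFullyAttachedOfLength a (l + 2)) s.dropLast
        (s.getLastD 0)) c}) fun s _ => (finite_setOf_minimal _).image _).subset ?_
    rintro t ⟨pre, b, c, rfl, h, -, -, hatt, hmin⟩
    refine Set.mem_biUnion h ⟨c, ?_, by simp⟩
    have h1 : (pre ++ [b]).dropLast = pre := by simp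
    have h2 : (pre ++ [b]).getLastD 0 = b := by simp
    rw [Set.mem_ofPred_eq, h1, h2]
    refine ⟨hatt, fun c' hc' hle => ?_⟩
    by_contra hne
    exact hmin c' hle (fun h => hne h.ge) hc'

/-- Letters have at least two entries, so removing one shortens the word and induction on the length
applies. -/
theorem finite_words (a : Ideal (MvPolynomial (Fin n) k)) (l : ℕ) :
    {W | W ∈ language a ∧ wordLength W = l}.Finite := by
  have key : ∀ l, {W : List (List (Fin n →₀ ℕ)) |
      (∀ p ∈ W, IsMinFullyAttached a p) ∧ wordLength W = l}.Finite := by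
    intro l
    induction l using Nat.strong_induction_on with
    | _ l ih =>
      have h1 : (⋃ m ∈ Set.Iic l, {t | IsMinFullyAttachedOfLength a m t}).Finite :=
        (Set.finite_Iic l).biUnion fun m _ => finite_isMinFullyAttachedOfLength a m
      have h2 : (⋃ m ∈ Set.Iio l, {W : List (List (Fin n →₀ ℕ)) |
          (∀ p ∈ W, IsMinFullyAttached a p) ∧ wordLength W = m}).Finite :=
        (Set.finite_Iio l).biUnion fun m hm => ih m hm
      refine ((Set.finite_singleton []).union (h1.image2 List.cons h2)).subset ?_
      rintro W ⟨hW, hl⟩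
      cases W with
      | nil => exact Or.inl rfl
      | cons t W =>
        rw [wordLength, List.map_cons, List.sum_cons] at hl
        have ht := hW t List.mem_cons_self
        have h3 := ht.two_le_length
        refine Or.inr ⟨t, Set.mem_biUnion (x := t.length) (by simp; omega) ht, W,
          Set.mem_biUnion (x := wordLength W) ?_
            ⟨fun p hp => hW p (List.mem_cons_of_mem _ hp), rfl⟩, rfl⟩
        rw [wordLength, Set.mem_Iio]
        omega
  exact (key l).subset fun W hW => ⟨hW.1.1, hW.2⟩

instance finite_cell (a : Ideal (MvPolynomial (Fin n) k)) (i : ℕ) :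
    Finite ((attachedSystem a).Cell i) := by
  have h1 : (⋃ m ∈ Set.Iic i, {W | W ∈ language a ∧ wordLength W = m}).Finite :=
    (Set.finite_Iic i).biUnion fun m _ => finite_words a m
  have := h1.to_subtype
  refine Finite.of_injective (β := Finset (Fin n) ×
    ↥(⋃ m ∈ Set.Iic i, {W | W ∈ language a ∧ wordLength W = m}))
    (fun c => (singleBlocks a c.1, ⟨cellWord a c.1, ?_⟩)) fun c c' h => ?_
  · refine Set.mem_biUnion (x := wordLength (cellWord a c.1)) ?_
      ⟨cellWord_mem_language c.2.1, rfl⟩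
    have := length_cell (a := a) c.2.1
    rw [c.2.2] at this
    rw [Set.mem_Iic]
    omega
  · obtain ⟨h2, h3⟩ := Prod.mk.inj h
    exact Subtype.ext (cell_eq_of_cellWord_eq c.2.1 c'.2.1 h2 (Subtype.mk.inj h3))

/-! ### Comparison of the numbers of cells with the coefficients. -/

theorem coeff_wordSeries (a : Ideal (MvPolynomial (Fin n) k)) (l : ℕ) (α : Fin n →₀ ℕ) :
    MvPowerSeries.coeff α (PowerSeries.coeff l (wordSeries a)) =
      Nat.card {W // W ∈ language a ∧ wordMonomial W = α ∧ wordLength W = l} :=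
  congrArg (MvPowerSeries.coeff α) (PowerSeries.coeff_mk _ _)

/-- Expands the product over subsets `J`. The condition on `J` guards the truncated subtractions. -/
theorem coeff_boundSeries (a : Ideal (MvPolynomial (Fin n) k)) (i : ℕ) (α : Fin n →₀ ℕ) :
    MvPowerSeries.coeff α (PowerSeries.coeff i (boundSeries a)) =
      ∑ J : Finset (Fin n), if J.card ≤ i ∧ ∑ j ∈ J, Finsupp.single j 1 ≤ α then
        Nat.card {W // W ∈ language a ∧ wordMonomial W = α - ∑ j ∈ J, Finsupp.single j 1 ∧
          wordLength W = i - J.card} else 0 := by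
  classical
  have h1 : ∀ J : Finset (Fin n), (∏ j ∈ J, (PowerSeries.C (MvPowerSeries.X j) *
      PowerSeries.X : PowerSeries (MvPowerSeries (Fin n) ℕ))) =
      PowerSeries.C (MvPowerSeries.monomial (∑ j ∈ J, Finsupp.single j 1) 1) *
        PowerSeries.X ^ J.card := by
    intro J
    rw [Finset.prod_mul_distrib, Finset.prod_const, ← map_prod]
    congr 2
    induction J using Finset.induction_on with
    | empty => simp
    | insert j J hj ih =>
      rw [Finset.prod_insert hj, Finset.sum_insert hj, ih, MvPowerSeries.X,
        MvPowerSeries.monomial_mul_monomial, one_mul]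
  rw [boundSeries, Finset.prod_one_add, Finset.sum_mul, map_sum, map_sum, Finset.powerset_univ]
  refine Finset.sum_congr rfl fun J _ => ?_
  rw [h1, mul_assoc, PowerSeries.coeff_C_mul, PowerSeries.coeff_X_pow_mul',
    MvPowerSeries.coeff_monomial_mul]
  by_cases h2 : J.card ≤ i
  · by_cases h3 : ∑ j ∈ J, Finsupp.single j 1 ≤ α
    · rw [if_pos h2, if_pos h3, if_pos ⟨h2, h3⟩, one_mul, coeff_wordSeries]
    · rw [if_neg h3, if_neg fun h : _ ∧ _ => h3 h.2]
  · rw [if_neg h2, if_neg fun h : J.card ≤ i ∧ _ => h2 h.1, map_zero, mul_zero, ite_self]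

theorem finite_support_boundSeries (a : Ideal (MvPolynomial (Fin n) k)) (i : ℕ) :
    {α : Fin n →₀ ℕ |
      MvPowerSeries.coeff α (PowerSeries.coeff i (boundSeries a)) ≠ 0}.Finite := by
  refine (Set.finite_iUnion fun J : Finset (Fin n) => (finite_words a (i - J.card)).image
    fun W => ∑ j ∈ J, Finsupp.single j 1 + wordMonomial W).subset ?_
  intro α hα
  rw [Set.mem_ofPred_eq, coeff_boundSeries] at hα
  obtain ⟨J, -, hJ⟩ := Finset.exists_ne_zero_of_sum_ne_zero hα
  split_ifs at hJ with h
  · obtain ⟨⟨W, hW, h1, h2⟩⟩ := (Nat.card_ne_zero.1 hJ).1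
    refine Set.mem_iUnion.2 ⟨J, W, ⟨hW, h2⟩, ?_⟩
    simp only [h1]
    exact add_tsub_cancel_of_le h.2
  · exact absurd rfl hJ

/-- Cells are sorted by their set `J` of one-variable blocks; within a fibre the word determines the
cell. -/
theorem card_cells_le (a : Ideal (MvPolynomial (Fin n) k)) (i : ℕ) (α : Fin n →₀ ℕ) :
    Nat.card {c : (attachedSystem a).Cell i // c.1.sum = α} ≤
      MvPowerSeries.coeff α (PowerSeries.coeff i (boundSeries a)) := by
  rw [coeff_boundSeries]
  rw [← Nat.card_congr (Equiv.sigmaFiberEquiv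
    fun c : {c : (attachedSystem a).Cell i // c.1.sum = α} => singleBlocks a c.1.1),
    Nat.card_sigma]
  refine Finset.sum_le_sum fun J _ => ?_
  split_ifs with h
  · have hfin := (finite_words a (i - J.card)).subset (t := {W | W ∈ language a ∧
      wordMonomial W = α - ∑ j ∈ J, Finsupp.single j 1 ∧ wordLength W = i - J.card})
      fun W hW => ⟨hW.1, hW.2.2⟩
    have : Finite {W // W ∈ language a ∧ wordMonomial W = α - ∑ j ∈ J, Finsupp.single j 1 ∧
        wordLength W = i - J.card} := hfin.to_subtype
    refine Nat.card_le_card_of_injective (fun c => ⟨cellWord a c.1.1.1, ?_⟩) fun c c' hcc => ?_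
    · obtain ⟨⟨c, hc⟩, rfl⟩ := c
      have h1 := sum_cell (a := a) c.2.1
      have h2 := length_cell (a := a) c.2.1
      rw [c.2.2] at h2
      exact ⟨cellWord_mem_language c.2.1,
        eq_tsub_of_add_eq ((add_comm _ _).trans (h1.symm.trans hc)),
        eq_tsub_of_add_eq ((add_comm _ _).trans h2.symm)⟩
    · exact Subtype.ext (Subtype.ext (Subtype.ext (cell_eq_of_cellWord_eq c.1.1.2.1 c'.1.1.2.1
        (c.2.trans c'.2.symm) (Subtype.mk.inj hcc))))
  · rw [Nat.le_zero, Nat.card_eq_zero]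
    refine Or.inl ⟨?_⟩
    rintro ⟨⟨c, rfl⟩, rfl⟩
    change ¬ ((singleBlocks a c.1).card ≤ i ∧
      ∑ j ∈ singleBlocks a c.1, Finsupp.single j 1 ≤ c.1.sum) at h
    have h1 := sum_cell (a := a) c.2.1
    have h2 := length_cell (a := a) c.2.1
    rw [c.2.2] at h2
    refine h ⟨by omega, ?_⟩
    rw [h1]
    exact le_self_add

theorem card_cells_weight_le {Γ : Type w} [AddCommMonoid Γ] (d : Fin n → Γ)
    (a : Ideal (MvPolynomial (Fin n) k)) (i : ℕ) (γ : Γ) :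
    Nat.card {c : (attachedSystem a).Cell i // Finsupp.weight d c.1.sum = γ} ≤
      ∑ᶠ α ∈ {α : Fin n →₀ ℕ | Finsupp.weight d α = γ},
        MvPowerSeries.coeff α (PowerSeries.coeff i (boundSeries a)) := by
  classical
  have := Fintype.ofFinite ((attachedSystem a).Cell i)
  have hfin := finite_support_boundSeries a i
  rw [finsum_mem_eq_sum_of_inter_support_eq (t := hfin.toFinset.filter fun α =>
    Finsupp.weight d α = γ) _ (by
      ext α
      simp [Function.mem_support]
      tauto), Nat.card_eq_fintype_card, Fintype.card_subtype,
    Finset.card_eq_sum_card_fiberwise (f := fun c : (attachedSystem a).Cell i => c.1.sum)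
      (t := hfin.toFinset.filter fun α => Finsupp.weight d α = γ)]
  · refine Finset.sum_le_sum fun α _ => le_trans ?_ (card_cells_le a i α)
    rw [Nat.card_eq_fintype_card, Fintype.card_subtype]
    refine Finset.card_le_card fun c hc => ?_
    simp only [Finset.mem_filter, Finset.mem_univ, true_and] at hc ⊢
    exact hc.2
  · intro c hc
    simp only [Finset.coe_filter, Finset.mem_univ, true_and, Set.mem_ofPred_eq] at hc
    simp only [Finset.coe_filter, Set.Finite.mem_toFinset, Set.mem_ofPred_eq]
    -- The coefficient at the monomial of `c` is nonzero because `c` itself is counted there.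
    refine ⟨fun h0 => ?_, hc⟩
    have h1 := card_cells_le a i c.1.sum
    rw [h0, Nat.le_zero, Nat.card_eq_zero] at h1
    rcases h1 with h1 | h1
    · exact h1.false ⟨c, rfl⟩
    · exact h1.not_finite inferInstance

theorem finrank_tor_le_finsum {Γ : Type w} [AddCommMonoid Γ] {d : Fin n → Γ}
    (ha : a ≤ idealOfVars (Fin n) k) (hd : IsHomogeneousFor d a)
    (R : GradedFreeResolution.{u, v, w} (algComponent d a) (augIdeal a)) (i : ℕ) (γ : Γ) :
    Module.Finite k (R.Tor i γ) ∧ Module.finrank k (R.Tor i γ) ≤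
      ∑ᶠ α ∈ {α : Fin n →₀ ℕ | Finsupp.weight d α = γ},
        MvPowerSeries.coeff α (PowerSeries.coeff i (boundSeries a)) := by
  obtain ⟨h1, h2⟩ := LetterSystem.finrank_tor_le_card ha hd (attachedSystem a) R i γ
  exact ⟨h1, h2.trans (card_cells_weight_le d a i γ)⟩

theorem weight_naturalDegree (α : Fin n →₀ ℕ) : Finsupp.weight (naturalDegree n) α = α := by
  rw [Finsupp.weight_apply]
  conv_rhs => rw [← Finsupp.sum_single α]
  simp [naturalDegree]

theorem coeff_poincareSeries {𝒜 : (Fin n →₀ ℕ) → Submodule k (MvPolynomial (Fin n) k ⧸ a)}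
    {𝔪 : Ideal (MvPolynomial (Fin n) k ⧸ a)} (R : GradedFreeResolution.{u, v, 0} 𝒜 𝔪) (i : ℕ)
    (α : Fin n →₀ ℕ) : MvPowerSeries.coeff α (PowerSeries.coeff i (poincareSeries R)) =
      Module.finrank k (R.Tor i α) :=
  congrArg (MvPowerSeries.coeff α) (PowerSeries.coeff_mk _ _)

end Counting

end AnickCommutative

open AnickCommutative in
theorem corollary3p4 {k : Type u} [Field k] {n : ℕ}
    (a : Ideal (MvPolynomial (Fin n) k))
    (ha : a ≤ MvPolynomial.idealOfVars (Fin n) k) :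
    -- `A` carries the natural multigrading
    (IsHomogeneousFor (naturalDegree n) a →
      ∀ R : GradedFreeResolution.{u, v, 0} (algComponent (naturalDegree n) a) (augIdeal a),
        (∀ (i : ℕ) (α : Fin n →₀ ℕ), Module.Finite k (R.Tor i α)) ∧
        ∀ (i : ℕ) (α : Fin n →₀ ℕ),
          MvPowerSeries.coeff α (PowerSeries.coeff i (poincareSeries R)) ≤
            MvPowerSeries.coeff α (PowerSeries.coeff i (boundSeries a))) ∧
    -- `A` carries the grading `deg x_i = d i` by a commutative monoid
    (∀ i : ℕ, {α : Fin n →₀ ℕ |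
        MvPowerSeries.coeff α (PowerSeries.coeff i (boundSeries a)) ≠ 0}.Finite) ∧
    (∀ {Γ : Type w} [AddCommMonoid Γ] (d : Fin n → Γ), IsHomogeneousFor d a →
      ∀ R : GradedFreeResolution.{u, v, w} (algComponent d a) (augIdeal a),
      ∀ (i : ℕ) (γ : Γ),
        Module.Finite k (R.Tor i γ) ∧
        Module.finrank k (R.Tor i γ) ≤
          ∑ᶠ α ∈ {α : Fin n →₀ ℕ | Finsupp.weight d α = γ},
            MvPowerSeries.coeff α (PowerSeries.coeff i (boundSeries a))) := by
  refine ⟨fun hd R => ?_, finite_support_boundSeries a, fun d hd R => finrank_tor_le_finsum ha hd R⟩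
  have h := finrank_tor_le_finsum ha hd R
  refine ⟨fun i α => (h i α).1, fun i α => ?_⟩
  have h1 := (h i α).2
  -- In the multigrading the weight is the identity, so the sum over exponents of weight `α` has a
  -- single term.
  have h2 : {β : Fin n →₀ ℕ | Finsupp.weight (naturalDegree n) β = α} = {α} := by
    ext β
    rw [Set.mem_ofPred_eq, weight_naturalDegree, Set.mem_singleton_iff]
  rwa [h2, finsum_mem_singleton, ← coeff_poincareSeries] at h1
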